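/- Let $G$ be a finite cyclic group. Let $B(G,G)$ be the double Burnside ring of $G$, that is, the Grothendieck group of finite $(G,G)$-bisets with respect to disjoint union, with product $[X][Y]=[X\times_G Y]$ and identity $\mathrm{Id}_G=[G]$. Let $a\mapsto a^\circ$ be the anti-involution of $B(G,G)$ induced by taking opposite bisets, and let $$B_\circ(G,G)=\{u\in B(G,G)^\times : uu^\circ=u^\circ u=\mathrm{Id}_G\}$$ be the group of orthogonal units. For $\varphi\in\mathrm{Aut}(G)$ let $\Delta_\varphi(G)=\{(\varphi(h),h) : h\in G\}\leqslant G\times G$ and let $\overline\varphi$ be the class of $\varphi$ in $\mathrm{Out}(G)$. Let $\eta:\mathbb{Z}\mathrm{Out}(G)\to B(G,G)$ be the ring homomorphism with $\eta(\overline\varphi)=[G\times G/\Delta_\varphi(G)]$, and let $\rho:B(G,G)\to\mathbb{Z}\mathrm{Out}(G)$ be the ring homomorphism with $\rho([G\times G/\Delta_\varphi(G)])=\overline\varphi$ for all $\varphi\in\mathrm{Aut}(G)$, and $\rho([G\times G/M])=0$ for every subgroup $M\leqslant G\times G$ that is not of the form $\Delta_\varphi(G)$. These restrict to group homomorphisms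 $$\eta:\langle-1,\mathrm{Out}(G)\rangle\to B_\circ(G,G),\qquad \rho^\times:B_\circ(G,G)\to\langle-1,\mathrm{Out}(G)\rangle,$$ where $\langle-1,\mathrm{Out}(G)\rangle\leqslant(\mathbb{Z}\mathrm{Out}(G))^\times$. Then the image $\eta(\mathbb{Z}\mathrm{Out}(G))$, and in particular the image $\mathrm{im}(\eta)$ of the restriction of $\eta$ to $\langle-1,\mathrm{Out}(G)\rangle$, lies in the center of $B(G,G)$, and $B_\circ(G,G)$ is the internal direct product $$B_\circ(G,G)=\mathrm{im}(\eta)\times\ker(\rho^\times).$$ -/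

import Mathlib

universe u

namespace DoubleBurnside

open MulOpposite

/-- A finite `(G, H)`-biset: a finite set with a left action of `G` and a right action of `H`
that commute. -/
structure Biset (G H : Type u) [Group G] [Group H] where
  carrier : Type u
  [finite : Finite carrier]
  [left : MulAction G carrier]
  [right : MulAction Hᵐᵒᵖ carrier]
  comm : ∀ (g : G) (h : H) (x : carrier), g • op h • x = op h • g • x

attribute [instance] Biset.finite Biset.left Biset.right

instance {G H : Type u} [Group G] [Group H] (X : Biset G H) :
    SMulCommClass G Hᵐᵒᵖ X.carrier :=
  ⟨fun g h x => X.comm g (unop h) x⟩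

section Basic

variable {G H K L : Type u} [Group G] [Group H] [Group K] [Group L]

/-- An isomorphism of bisets: a bijection that is equivariant on both sides. -/
structure Biset.Iso (X Y : Biset G H) extends X.carrier ≃ Y.carrier where
  map_left : ∀ (g : G) (x : X.carrier), toFun (g • x) = g • toFun x
  map_right : ∀ (h : H) (x : X.carrier), toFun (op h • x) = op h • toFun x

/-- Two bisets are equivalent if they are isomorphic. -/
instance Biset.setoid (G H : Type u) [Group G] [Group H] : Setoid (Biset G H) where
  r X Y := Nonempty (Biset.Iso X Y)
  iseqv :=
    { refl := fun X => ⟨⟨Equiv.refl _, fun _ _ => rfl, fun _ _ => rfl⟩⟩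
      symm := by
        rintro X Y ⟨e⟩
        refine ⟨⟨e.toEquiv.symm, fun g y => ?_, fun h y => ?_⟩⟩
        · apply e.toEquiv.injective
          have := e.map_left g (e.toEquiv.symm y)
          simp only [Equiv.toFun_as_coe, Equiv.apply_symm_apply] at this ⊢
          exact this.symm
        · apply e.toEquiv.injective
          have := e.map_right h (e.toEquiv.symm y)
          simp only [Equiv.toFun_as_coe, Equiv.apply_symm_apply] at this ⊢
          exact this.symm
      trans := by
        rintro X Y Z ⟨e⟩ ⟨f⟩
        refine ⟨⟨e.toEquiv.trans f.toEquiv, fun g x => ?_, fun h x => ?_⟩⟩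
        · exact (congrArg f.toFun (e.map_left g x)).trans (f.map_left g _)
        · exact (congrArg f.toFun (e.map_right h x)).trans (f.map_right h _) }

/-- The empty biset. -/
def Biset.empty (G H : Type u) [Group G] [Group H] : Biset G H :=
  { carrier := PEmpty
    left :=
      { smul := fun _ x => x, one_smul := fun _ => rfl, mul_smul := fun _ _ _ => rfl }
    right :=
      { smul := fun _ x => x, one_smul := fun _ => rfl, mul_smul := fun _ _ _ => rfl }
    comm := fun _ _ _ => rfl }

/-- The disjoint union of two bisets. -/
def Biset.sum (X Y : Biset G H) : Biset G H :=
  { carrier := X.carrier ⊕ Y.carrier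
    comm := fun g h x => smul_comm g (op h) x }

/-- The group `G` as a `(G, G)`-biset, with left and right multiplication. -/
def Biset.regular (G : Type u) [Group G] [Finite G] : Biset G G :=
  { carrier := G
    comm := fun g h x => smul_comm g (op h) x }

/-- The `H`-orbits on `X × Y` for the action `h • (x, y) = (x h⁻¹, h y)`. -/
def tensorSetoid (X : Biset G H) (Y : Biset H K) : Setoid (X.carrier × Y.carrier) where
  r p q := ∃ h : H, q = (op h⁻¹ • p.1, h • p.2)
  iseqv :=
    { refl := fun p => ⟨1, by simp⟩
      symm := by
        rintro p q ⟨h, rfl⟩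
        exact ⟨h⁻¹, by simp [smul_smul]⟩
      trans := by
        rintro p q r ⟨h, rfl⟩ ⟨k, rfl⟩
        exact ⟨k * h, by simp [smul_smul]⟩ }

/-- The tensor product `X ×_H Y` of bisets, with its natural actions
`g (x, y) = (g x, y)` and `(x, y) k = (x, y k)`. -/
def Biset.tensor (X : Biset G H) (Y : Biset H K) : Biset G K :=
  { carrier := Quotient (tensorSetoid X Y)
    finite := Quotient.finite _
    left :=
      { smul := fun g => Quotient.map (fun p => (g • p.1, p.2)) (by
          rintro p q ⟨h, rfl⟩
          exact ⟨h, by simp [smul_comm]⟩)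
        one_smul := by
          rintro ⟨p⟩
          exact congrArg (Quotient.mk _) (by simp)
        mul_smul := by
          rintro a b ⟨p⟩
          exact congrArg (Quotient.mk _) (by simp [mul_smul]) }
    right :=
      { smul := fun k => Quotient.map (fun p => (p.1, k • p.2)) (by
          rintro p q ⟨h, rfl⟩
          exact ⟨h, by simp [smul_comm]⟩)
        one_smul := by
          rintro ⟨p⟩
          exact congrArg (Quotient.mk _) (by simp)
        mul_smul := by
          rintro a b ⟨p⟩
          exact congrArg (Quotient.mk _) (by simp [mul_smul]) }
    comm := by
      rintro a b ⟨p⟩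
      rfl }

/-- The element `(x ,_H y)` of the tensor product. -/
def Biset.tmk {X : Biset G H} {Y : Biset H K} (x : X.carrier) (y : Y.carrier) :
    (X.tensor Y).carrier :=
  Quotient.mk (tensorSetoid X Y) (x, y)

theorem tmk_surj {X : Biset G H} {Y : Biset H K} (p : (X.tensor Y).carrier) :
    ∃ x y, p = Biset.tmk x y := by
  obtain ⟨⟨x, y⟩, rfl⟩ := Quotient.exists_rep p
  exact ⟨x, y, rfl⟩

theorem tmk_eq_iff {X : Biset G H} {Y : Biset H K} {x x' : X.carrier} {y y' : Y.carrier} :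
    Biset.tmk x y = Biset.tmk x' y' ↔ ∃ h : H, x' = op h⁻¹ • x ∧ y' = h • y := by
  refine (Quotient.eq (r := tensorSetoid X Y)).trans ?_
  exact exists_congr fun h => Prod.ext_iff

theorem tmk_smul {X : Biset G H} {Y : Biset H K} (h : H) (x : X.carrier) (y : Y.carrier) :
    Biset.tmk (op h • x) y = Biset.tmk x (h • y) :=
  tmk_eq_iff.2 ⟨h, by simp [smul_smul], rfl⟩

theorem smul_tmk {X : Biset G H} {Y : Biset H K} (g : G) (x : X.carrier) (y : Y.carrier) :
    g • Biset.tmk x y = Biset.tmk (g • x) y := rfl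

theorem op_smul_tmk {X : Biset G H} {Y : Biset H K} (k : K) (x : X.carrier) (y : Y.carrier) :
    op k • Biset.tmk x y = Biset.tmk x (op k • y) := rfl

/-- A function on the tensor product from a balanced function. -/
def Biset.tlift {X : Biset G H} {Y : Biset H K} {A : Type u} (f : X.carrier → Y.carrier → A)
    (hf : ∀ (h : H) x y, f (op h • x) y = f x (h • y)) : (X.tensor Y).carrier → A :=
  Quotient.lift (fun p => f p.1 p.2) (by
    rintro p q ⟨h, rfl⟩
    have := hf h (op h⁻¹ • p.1) p.2
    simpa [smul_smul, ← op_mul] using this)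

theorem tlift_tmk {X : Biset G H} {Y : Biset H K} {A : Type u} (f : X.carrier → Y.carrier → A)
    (hf : ∀ (h : H) x y, f (op h • x) y = f x (h • y)) (x : X.carrier) (y : Y.carrier) :
    Biset.tlift f hf (Biset.tmk x y) = f x y := rfl

/-- The opposite biset: the same set, with `h • x • g = g⁻¹ x h⁻¹`. -/
def Biset.opposite (X : Biset G H) : Biset H G :=
  { carrier := X.carrier
    left :=
      { smul := fun h x => op h⁻¹ • x
        one_smul := fun x => by change op (1 : H)⁻¹ • x = x; simp
        mul_smul := fun a b x => by
          change op (a * b)⁻¹ • x = op a⁻¹ • op b⁻¹ • x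
          simp [smul_smul] }
    right :=
      { smul := fun g x => (unop g)⁻¹ • x
        one_smul := fun x => by change (unop (1 : Gᵐᵒᵖ))⁻¹ • x = x; simp
        mul_smul := fun a b x => by
          change (unop (a * b))⁻¹ • x = (unop a)⁻¹ • (unop b)⁻¹ • x
          simp [smul_smul] }
    comm := fun a b x => (smul_comm b⁻¹ (op a⁻¹) x).symm }

/-- The transitive biset `G × H / M`, where `g x h = (g, h⁻¹) x`. -/
def Biset.coset [Finite G] [Finite H] (M : Subgroup (G × H)) : Biset G H :=
  { carrier := (G × H) ⧸ M
    left :=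
      { smul := fun g x => ((g, 1) : G × H) • x
        one_smul := fun x => one_smul (G × H) x
        mul_smul := fun a b x => by
          change ((a * b, 1) : G × H) • x = ((a, 1) : G × H) • ((b, 1) : G × H) • x
          simp [smul_smul] }
    right :=
      { smul := fun h x => ((1, (unop h)⁻¹) : G × H) • x
        one_smul := fun x => by
          change ((1, (unop (1 : Hᵐᵒᵖ))⁻¹) : G × H) • x = x
          simp [← Prod.one_eq_mk]
        mul_smul := fun a b x => by
          change ((1, (unop (a * b))⁻¹) : G × H) • x
            = ((1, (unop a)⁻¹) : G × H) • ((1, (unop b)⁻¹) : G × H) • x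
          simp [smul_smul] }
    comm := fun a b x => by
      change ((a, 1) : G × H) • ((1, b⁻¹) : G × H) • x
            = ((1, b⁻¹) : G × H) • ((a, 1) : G × H) • x
      simp [smul_smul] }

/-- Isomorphism classes of finite `(G, H)`-bisets. -/
def BisetClass (G H : Type u) [Group G] [Group H] : Type (u + 1) :=
  Quotient (Biset.setoid G H)

/-- The isomorphism class of a biset. -/
def Biset.cls (X : Biset G H) : BisetClass G H := Quotient.mk _ X

theorem cls_eq {X Y : Biset G H} (e : X.carrier ≃ Y.carrier)
    (h₁ : ∀ (g : G) x, e (g • x) = g • e x) (h₂ : ∀ (h : H) x, e (op h • x) = op h • e x) :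
    X.cls = Y.cls :=
  Quotient.sound ⟨⟨e, h₁, h₂⟩⟩

theorem exists_iso_of_cls_eq {X Y : Biset G H} (h : X.cls = Y.cls) :
    ∃ e : X.carrier ≃ Y.carrier,
    (∀ (g : G) x, e (g • x) = g • e x) ∧ (∀ (h : H) x, e (op h • x) = op h • e x) := by
  obtain ⟨e⟩ := Quotient.exact h
  exact ⟨e.toEquiv, e.map_left, e.map_right⟩

instance : Zero (BisetClass G H) := ⟨(Biset.empty G H).cls⟩

instance : Add (BisetClass G H) where
  add := Quotient.map₂ Biset.sum (by
    rintro X X' ⟨e⟩ Y Y' ⟨f⟩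
    refine ⟨⟨Equiv.sumCongr e.toEquiv f.toEquiv, ?_, ?_⟩⟩
    · rintro g (x | y)
      · exact congrArg Sum.inl (e.map_left g x)
      · exact congrArg Sum.inr (f.map_left g y)
    · rintro g (x | y)
      · exact congrArg Sum.inl (e.map_right g x)
      · exact congrArg Sum.inr (f.map_right g y))

/-- Isomorphism classes form a commutative monoid under disjoint union. -/
instance : AddCommMonoid (BisetClass G H) where
  add_assoc := by
    rintro ⟨X⟩ ⟨Y⟩ ⟨Z⟩
    refine cls_eq (X := (X.sum Y).sum Z) (Y := X.sum (Y.sum Z)) (Equiv.sumAssoc _ _ _) ?_ ?_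
    · rintro g ((x | y) | z) <;> rfl
    · rintro g ((x | y) | z) <;> rfl
  zero_add := by
    rintro ⟨X⟩
    refine cls_eq (X := (Biset.empty G H).sum X) (Y := X) (Equiv.emptySum PEmpty _) ?_ ?_
    · rintro g (x | y)
      · exact x.elim
      · rfl
    · rintro g (x | y)
      · exact x.elim
      · rfl
  add_zero := by
    rintro ⟨X⟩
    refine cls_eq (X := X.sum (Biset.empty G H)) (Y := X) (Equiv.sumEmpty _ PEmpty) ?_ ?_
    · rintro g (x | y)
      · rfl
      · exact y.elim
    · rintro g (x | y)
      · rfl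
      · exact y.elim
  add_comm := by
    rintro ⟨X⟩ ⟨Y⟩
    refine cls_eq (X := X.sum Y) (Y := Y.sum X) (Equiv.sumComm _ _) ?_ ?_
    · rintro g (x | y) <;> rfl
    · rintro g (x | y) <;> rfl
  nsmul := nsmulRec

theorem cls_add (X Y : Biset G H) : X.cls + Y.cls = (X.sum Y).cls := rfl

theorem cls_zero : (0 : BisetClass G H) = (Biset.empty G H).cls := rfl

theorem tensor_congr {X X' : Biset G H} {Y Y' : Biset H K} (hX : X.cls = X'.cls)
    (hY : Y.cls = Y'.cls) : (X.tensor Y).cls = (X'.tensor Y').cls := by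
  obtain ⟨e, e₁, e₂⟩ := exists_iso_of_cls_eq hX
  obtain ⟨f, f₁, f₂⟩ := exists_iso_of_cls_eq hY
  have he : ∀ (h : H) x, e.symm (op h • x) = op h • e.symm x := fun h x => by
    apply e.injective; simp [e₂]
  have hf : ∀ (h : H) y, f.symm (h • y) = h • f.symm y := fun h y => by
    apply f.injective; simp [f₁]
  let E : (X.tensor Y).carrier ≃ (X'.tensor Y').carrier :=
    { toFun := Biset.tlift (fun x y => Biset.tmk (e x) (f y))
        (fun h x y => by rw [e₂, f₁, tmk_smul])
      invFun := Biset.tlift (fun x y => Biset.tmk (e.symm x) (f.symm y))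
        (fun h x y => by rw [he, hf, tmk_smul])
      left_inv := fun p => by
        obtain ⟨x, y, rfl⟩ := tmk_surj p
        simp [tlift_tmk]
      right_inv := fun p => by
        obtain ⟨x, y, rfl⟩ := tmk_surj p
        simp [tlift_tmk] }
  refine cls_eq E (fun g p => ?_) (fun k p => ?_)
  · obtain ⟨x, y, rfl⟩ := tmk_surj p
    exact congrArg (fun z => Biset.tmk z (f y)) (e₁ g x)
  · obtain ⟨x, y, rfl⟩ := tmk_surj p
    exact congrArg (Biset.tmk (e x)) (f₂ k y)

/-- The tensor product of isomorphism classes of bisets. -/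
def tensorClass : BisetClass G H → BisetClass H K → BisetClass G K :=
  Quotient.map₂ Biset.tensor (fun _ _ hX _ _ hY =>
    Quotient.exact (tensor_congr (Quotient.sound hX) (Quotient.sound hY)))

theorem tensorClass_cls (X : Biset G H) (Y : Biset H K) :
    tensorClass X.cls Y.cls = (X.tensor Y).cls := rfl

theorem tensorClass_zero_left (b : BisetClass H K) :
    tensorClass (0 : BisetClass G H) b = 0 := by
  obtain ⟨Y⟩ := b
  have h₁ : IsEmpty ((Biset.empty G H).tensor Y).carrier := ⟨fun p => by
    obtain ⟨x, y, rfl⟩ := tmk_surj p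
    exact PEmpty.elim x⟩
  have h₂ : IsEmpty (Biset.empty G K).carrier := ⟨fun x => PEmpty.elim x⟩
  exact cls_eq (X := (Biset.empty G H).tensor Y) (Y := Biset.empty G K)
    (Equiv.equivOfIsEmpty _ _) (fun _ x => h₁.elim x) (fun _ x => h₁.elim x)

theorem tensorClass_zero_right (a : BisetClass G H) :
    tensorClass a (0 : BisetClass H K) = 0 := by
  obtain ⟨X⟩ := a
  have h₁ : IsEmpty (X.tensor (Biset.empty H K)).carrier := ⟨fun p => by
    obtain ⟨x, y, rfl⟩ := tmk_surj p
    exact PEmpty.elim y⟩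
  have h₂ : IsEmpty (Biset.empty G K).carrier := ⟨fun x => PEmpty.elim x⟩
  exact cls_eq (X := X.tensor (Biset.empty H K)) (Y := Biset.empty G K)
    (Equiv.equivOfIsEmpty _ _) (fun _ x => h₁.elim x) (fun _ x => h₁.elim x)

theorem tensorClass_add_left (a a' : BisetClass G H) (b : BisetClass H K) :
    tensorClass (a + a') b = tensorClass a b + tensorClass a' b := by
  obtain ⟨X⟩ := a
  obtain ⟨X'⟩ := a'
  obtain ⟨Y⟩ := b
  let E : ((X.sum X').tensor Y).carrier ≃ ((X.tensor Y).sum (X'.tensor Y)).carrier :=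
    { toFun := Biset.tlift
        (fun s y => Sum.map (fun x => Biset.tmk x y) (fun x => Biset.tmk x y) s)
        (by
          rintro h (x | x) y
          · exact congrArg Sum.inl (tmk_smul h x y)
          · exact congrArg Sum.inr (tmk_smul h x y))
      invFun := Sum.elim
        (Biset.tlift (fun x y => Biset.tmk (X := X.sum X') (Sum.inl x) y)
          (fun h x y => tmk_smul (X := X.sum X') h (Sum.inl x) y))
        (Biset.tlift (fun x y => Biset.tmk (X := X.sum X') (Sum.inr x) y)
          (fun h x y => tmk_smul (X := X.sum X') h (Sum.inr x) y))
      left_inv := fun p => by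
        obtain ⟨x | x, y, rfl⟩ := tmk_surj p <;> rfl
      right_inv := by
        rintro (p | p)
        · obtain ⟨x, y, rfl⟩ := tmk_surj p
          rfl
        · obtain ⟨x, y, rfl⟩ := tmk_surj p
          rfl }
  refine cls_eq E (fun g p => ?_) (fun k p => ?_)
  · obtain ⟨x | x, y, rfl⟩ := tmk_surj p <;> rfl
  · obtain ⟨x | x, y, rfl⟩ := tmk_surj p <;> rfl

theorem tensorClass_add_right (a : BisetClass G H) (b b' : BisetClass H K) :
    tensorClass a (b + b') = tensorClass a b + tensorClass a b' := by
  obtain ⟨X⟩ := a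
  obtain ⟨Y⟩ := b
  obtain ⟨Y'⟩ := b'
  let E : (X.tensor (Y.sum Y')).carrier ≃ ((X.tensor Y).sum (X.tensor Y')).carrier :=
    { toFun := Biset.tlift
        (fun x s => Sum.map (fun y => Biset.tmk x y) (fun y => Biset.tmk x y) s)
        (by
          rintro h x (y | y)
          · exact congrArg Sum.inl (tmk_smul h x y)
          · exact congrArg Sum.inr (tmk_smul h x y))
      invFun := Sum.elim
        (Biset.tlift (fun x y => Biset.tmk (Y := Y.sum Y') x (Sum.inl y))
          (fun h x y => tmk_smul (Y := Y.sum Y') h x (Sum.inl y)))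
        (Biset.tlift (fun x y => Biset.tmk (Y := Y.sum Y') x (Sum.inr y))
          (fun h x y => tmk_smul (Y := Y.sum Y') h x (Sum.inr y)))
      left_inv := fun p => by
        obtain ⟨x, y | y, rfl⟩ := tmk_surj p <;> rfl
      right_inv := by
        rintro (p | p)
        · obtain ⟨x, y, rfl⟩ := tmk_surj p
          rfl
        · obtain ⟨x, y, rfl⟩ := tmk_surj p
          rfl }
  refine cls_eq E (fun g p => ?_) (fun k p => ?_)
  · obtain ⟨x, y | y, rfl⟩ := tmk_surj p <;> rfl
  · obtain ⟨x, y | y, rfl⟩ := tmk_surj p <;> rfl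

theorem tensorClass_assoc (a : BisetClass G H) (b : BisetClass H K) (c : BisetClass K L) :
    tensorClass (tensorClass a b) c = tensorClass a (tensorClass b c) := by
  obtain ⟨X⟩ := a
  obtain ⟨Y⟩ := b
  obtain ⟨Z⟩ := c
  let E : ((X.tensor Y).tensor Z).carrier ≃ (X.tensor (Y.tensor Z)).carrier :=
    { toFun := Biset.tlift
        (fun p z => Biset.tlift (fun x y => Biset.tmk x (Biset.tmk y z))
          (fun h x y => by rw [tmk_smul, smul_tmk]) p)
        (by
          intro k p z
          obtain ⟨x, y, rfl⟩ := tmk_surj p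
          exact congrArg (Biset.tmk x) (tmk_smul k y z))
      invFun := Biset.tlift
        (fun x q => Biset.tlift (fun y z => Biset.tmk (Biset.tmk x y) z)
          (fun k y z => by rw [← op_smul_tmk, tmk_smul]) q)
        (by
          intro h x q
          obtain ⟨y, z, rfl⟩ := tmk_surj q
          exact congrArg (fun w => Biset.tmk w z) (tmk_smul h x y))
      left_inv := fun p => by
        obtain ⟨q, z, rfl⟩ := tmk_surj p
        obtain ⟨x, y, rfl⟩ := tmk_surj q
        rfl
      right_inv := fun p => by
        obtain ⟨x, q, rfl⟩ := tmk_surj p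
        obtain ⟨y, z, rfl⟩ := tmk_surj q
        rfl }
  refine cls_eq E (fun g p => ?_) (fun k p => ?_)
  · obtain ⟨q, z, rfl⟩ := tmk_surj p
    obtain ⟨x, y, rfl⟩ := tmk_surj q
    rfl
  · obtain ⟨q, z, rfl⟩ := tmk_surj p
    obtain ⟨x, y, rfl⟩ := tmk_surj q
    rfl

theorem tensorClass_one_left [Finite G] (b : BisetClass G H) :
    tensorClass (Biset.regular G).cls b = b := by
  obtain ⟨Y⟩ := b
  let E : ((Biset.regular G).tensor Y).carrier ≃ Y.carrier :=
    { toFun := Biset.tlift (fun (x : G) y => x • y) (fun h (x : G) y => mul_smul (α := G) x h y)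
      invFun := fun y => Biset.tmk (X := Biset.regular G) (1 : G) y
      left_inv := fun p => by
        obtain ⟨x, y, rfl⟩ := tmk_surj p
        change G at x
        have := tmk_smul (X := Biset.regular G) x (1 : G) y
        refine this.symm.trans ?_
        exact congrArg (fun w => Biset.tmk (X := Biset.regular G) w y) (one_mul x)
      right_inv := fun y => one_smul G y }
  refine cls_eq E (fun g p => ?_) (fun k p => ?_)
  · obtain ⟨x, y, rfl⟩ := tmk_surj p
    exact mul_smul (α := G) g x y
  · obtain ⟨x, y, rfl⟩ := tmk_surj p
    exact smul_comm (M := G) x (op k) y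

theorem tensorClass_one_right [Finite H] (a : BisetClass G H) :
    tensorClass a (Biset.regular H).cls = a := by
  obtain ⟨X⟩ := a
  let E : (X.tensor (Biset.regular H)).carrier ≃ X.carrier :=
    { toFun := Biset.tlift (fun x (y : H) => op y • x)
        (fun h x (y : H) => (mul_smul (op y) (op h) x).symm)
      invFun := fun x => Biset.tmk (Y := Biset.regular H) x (1 : H)
      left_inv := fun p => by
        obtain ⟨x, y, rfl⟩ := tmk_surj p
        change H at y
        have := tmk_smul (Y := Biset.regular H) y x (1 : H)
        refine this.trans ?_
        exact congrArg (fun w => Biset.tmk (Y := Biset.regular H) x w) (mul_one y)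
      right_inv := fun x => one_smul Hᵐᵒᵖ x }
  refine cls_eq E (fun g p => ?_) (fun k p => ?_)
  · obtain ⟨x, y, rfl⟩ := tmk_surj p
    exact (X.comm g y x).symm
  · obtain ⟨x, y, rfl⟩ := tmk_surj p
    exact mul_smul (α := Hᵐᵒᵖ) (op k) (op y) x

theorem opposite_smul (X : Biset G H) (h : H) (x : X.carrier) :
    (h • (show X.opposite.carrier from x) : X.opposite.carrier) = (op h⁻¹ • x : X.carrier) := rfl

theorem opposite_op_smul (X : Biset G H) (g : G) (x : X.carrier) :
    (op g • (show X.opposite.carrier from x) : X.opposite.carrier) = (g⁻¹ • x : X.carrier) := rfl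

/-- The opposite on isomorphism classes, as an additive map. -/
def oppositeClass : BisetClass G H →+ BisetClass H G where
  toFun := Quotient.map Biset.opposite (by
    rintro X Y ⟨e⟩
    exact ⟨⟨e.toEquiv, fun h x => e.map_right h⁻¹ x, fun g x => e.map_left g⁻¹ x⟩⟩)
  map_zero' := cls_eq (X := (Biset.empty G H).opposite) (Y := Biset.empty H G)
    (Equiv.refl _) (fun _ x => PEmpty.elim x) (fun _ x => PEmpty.elim x)
  map_add' := by
    rintro ⟨X⟩ ⟨Y⟩
    refine cls_eq (X := (X.sum Y).opposite) (Y := X.opposite.sum Y.opposite)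
      (Equiv.refl _) ?_ ?_
    · rintro h (x | y) <;> rfl
    · rintro h (x | y) <;> rfl

theorem oppositeClass_cls (X : Biset G H) : oppositeClass X.cls = X.opposite.cls := rfl

theorem oppositeClass_oppositeClass (a : BisetClass G H) :
    oppositeClass (oppositeClass a) = a := by
  obtain ⟨X⟩ := a
  exact cls_eq (X := X.opposite.opposite) (Y := X) (Equiv.refl _)
    (fun g (x : X.carrier) => congrArg (fun a : G => a • x) (inv_inv g))
    (fun h (x : X.carrier) => congrArg (fun a : H => op a • x) (inv_inv h))

theorem oppositeClass_one [Finite G] :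
    oppositeClass (Biset.regular G).cls = (Biset.regular G).cls := by
  refine cls_eq (X := (Biset.regular G).opposite) (Y := Biset.regular G) (Equiv.inv G)
    (fun g (x : G) => ?_) (fun g (x : G) => ?_)
  · change (x * g⁻¹)⁻¹ = g * x⁻¹
    simp
  · change (g⁻¹ * x)⁻¹ = x⁻¹ * g
    simp

theorem oppositeClass_tensorClass (a : BisetClass G H) (b : BisetClass H K) :
    oppositeClass (tensorClass a b) = tensorClass (oppositeClass b) (oppositeClass a) := by
  obtain ⟨X⟩ := a
  obtain ⟨Y⟩ := b
  let E : (X.tensor Y).opposite.carrier ≃ (Y.opposite.tensor X.opposite).carrier :=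
    { toFun := Biset.tlift (X := X) (Y := Y)
        (fun x y => Biset.tmk (X := Y.opposite) (Y := X.opposite) y x)
        (fun h x y => by
          have := tmk_smul (X := Y.opposite) (Y := X.opposite) h⁻¹ y x
          rw [opposite_op_smul, opposite_smul, inv_inv] at this
          exact this.symm)
      invFun := Biset.tlift (X := Y.opposite) (Y := X.opposite)
        (fun y x => Biset.tmk (X := X) (Y := Y) x y)
        (fun h y x => by
          have := tmk_smul (X := X) (Y := Y) h⁻¹ x y
          exact this.symm)
      left_inv := fun p => by
        obtain ⟨x, y, rfl⟩ := tmk_surj (X := X) (Y := Y) p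
        rfl
      right_inv := fun p => by
        obtain ⟨x, y, rfl⟩ := tmk_surj p
        rfl }
  refine cls_eq (X := (X.tensor Y).opposite) (Y := Y.opposite.tensor X.opposite) E
    (fun g p => ?_) (fun k p => ?_)
  · obtain ⟨x, y, rfl⟩ := tmk_surj (X := X) (Y := Y) p
    rfl
  · obtain ⟨x, y, rfl⟩ := tmk_surj (X := X) (Y := Y) p
    rfl

end Basic

/-- `B(G, H)`: the Grothendieck group of finite `(G, H)`-bisets under disjoint union. -/
def BurnsideGroup (G H : Type u) [Group G] [Group H] : Type (u + 1) :=
  Algebra.GrothendieckAddGroup (BisetClass G H)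

namespace BurnsideGroup

section Additive

variable {G H K L : Type u} [Group G] [Group H] [Group K] [Group L]

instance : AddCommGroup (BurnsideGroup G H) :=
  inferInstanceAs (AddCommGroup (Algebra.GrothendieckAddGroup (BisetClass G H)))

/-- The element of `B(G, H)` given by an isomorphism class of bisets. -/
def of : BisetClass G H →+ BurnsideGroup G H :=
  Algebra.GrothendieckAddGroup.of

/-- The universal property of `B(G, H)`. -/
noncomputable def lift {A : Type*} [AddCommGroup A] (f : BisetClass G H →+ A) :
    BurnsideGroup G H →+ A :=
  Algebra.GrothendieckAddGroup.lift f

theorem lift_of {A : Type*} [AddCommGroup A] (f : BisetClass G H →+ A) (a : BisetClass G H) :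
    lift f (of a) = f a :=
  DFunLike.congr_fun (Algebra.GrothendieckAddGroup.lift.symm_apply_apply f) a

theorem hom_ext {A : Type*} [AddCommGroup A] {f g : BurnsideGroup G H →+ A}
    (h : ∀ X : Biset G H, f (of X.cls) = g (of X.cls)) : f = g :=
  Algebra.GrothendieckAddGroup.lift.symm.injective <| by
    ext ⟨X⟩
    exact h X

/-- The class `[X]` in `B(G, H)` of a finite biset. -/
def mk (X : Biset G H) : BurnsideGroup G H := of X.cls

/-- The biadditive product `B(G, H) × B(H, K) → B(G, K)` with `[X] [Y] = [X ×_H Y]`. -/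
noncomputable def comp : BurnsideGroup G H →+ BurnsideGroup H K →+ BurnsideGroup G K :=
  lift
    { toFun := fun a => lift
        { toFun := fun b => of (tensorClass a b)
          map_zero' := by rw [tensorClass_zero_right, map_zero]
          map_add' := fun b b' => by rw [tensorClass_add_right, map_add] }
      map_zero' := hom_ext fun Y => by
        rw [lift_of]
        exact (congrArg of (tensorClass_zero_left _)).trans (map_zero _)
      map_add' := fun a a' => hom_ext fun Y => by
        rw [AddMonoidHom.add_apply, lift_of, lift_of, lift_of]
        exact (congrArg of (tensorClass_add_left a a' _)).trans (map_add _ _ _) }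

theorem comp_mk (X : Biset G H) (Y : Biset H K) : comp (mk X) (mk Y) = mk (X.tensor Y) := by
  unfold comp mk
  rw [lift_of]
  exact lift_of _ _

theorem comp_assoc (a : BurnsideGroup G H) (b : BurnsideGroup H K) (c : BurnsideGroup K L) :
    comp (comp a b) c = comp a (comp b c) := by
  have h₃ : ∀ (X : Biset G H) (Y : Biset H K),
      (comp (comp (mk X) (mk Y)) : BurnsideGroup K L →+ _) =
        (comp (mk X)).comp (comp (mk Y)) := fun X Y => hom_ext fun Z => by
    change comp (comp (mk X) (mk Y)) (mk Z) = comp (mk X) (comp (mk Y) (mk Z))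
    rw [comp_mk, comp_mk, comp_mk, comp_mk]
    exact congrArg of (tensorClass_assoc X.cls Y.cls Z.cls)
  have h₂ : ∀ (X : Biset G H) (c : BurnsideGroup K L),
      (comp.flip c).comp (comp (mk X) : BurnsideGroup H K →+ _) =
        (comp (mk X)).comp (comp.flip c) := fun X c => hom_ext fun Y =>
    DFunLike.congr_fun (h₃ X Y) c
  have h₁ : (comp.flip c).comp (comp.flip b : BurnsideGroup G H →+ _) =
      comp.flip (comp b c) := hom_ext fun X => DFunLike.congr_fun (h₂ X c) b
  exact DFunLike.congr_fun h₁ a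

/-- Duality `B(G, H) → B(H, G)`, induced by taking opposite bisets. -/
noncomputable def dual : BurnsideGroup G H →+ BurnsideGroup H G :=
  lift (of.comp oppositeClass)

theorem dual_mk (X : Biset G H) : dual (mk X) = mk X.opposite := lift_of _ _

theorem dual_dual (a : BurnsideGroup G H) : dual (dual a) = a := by
  have : (dual.comp dual : BurnsideGroup G H →+ _) = AddMonoidHom.id _ := hom_ext fun X => by
    change dual (dual (mk X)) = mk X
    rw [dual_mk, dual_mk]
    exact congrArg of (oppositeClass_oppositeClass X.cls)
  exact DFunLike.congr_fun this a

theorem dual_comp (a : BurnsideGroup G H) (b : BurnsideGroup H K) :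
    dual (comp a b) = comp (dual b) (dual a) := by
  have h₂ : ∀ X : Biset G H, dual.comp (comp (mk X) : BurnsideGroup H K →+ _) =
      (comp.flip (dual (mk X))).comp dual := fun X => hom_ext fun Y => by
    change dual (comp (mk X) (mk Y)) = comp (dual (mk Y)) (dual (mk X))
    rw [comp_mk, dual_mk, dual_mk, dual_mk, comp_mk]
    exact congrArg of (oppositeClass_tensorClass X.cls Y.cls)
  have h₁ : dual.comp (comp.flip b : BurnsideGroup G H →+ _) =
      (comp (dual b)).comp dual := hom_ext fun X => DFunLike.congr_fun (h₂ X) b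
  exact DFunLike.congr_fun h₁ a

end Additive

/-- The double Burnside ring `B(G, G)`, with product `[X] [Y] = [X ×_G Y]` and identity `[G]`. -/
noncomputable instance (G : Type u) [Group G] [Finite G] : Ring (BurnsideGroup G G) where
  mul a b := comp a b
  one := mk (Biset.regular G)
  left_distrib a b c := map_add (comp a) b c
  right_distrib a b c := DFunLike.congr_fun (map_add comp a b) c
  zero_mul a := DFunLike.congr_fun (map_zero comp) a
  mul_zero a := map_zero (comp a)
  mul_assoc := comp_assoc
  one_mul a := by
    have : (comp (mk (Biset.regular G)) : BurnsideGroup G G →+ _) = AddMonoidHom.id _ :=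
      hom_ext fun X => by
        change comp (mk _) (mk X) = mk X
        rw [comp_mk]
        exact congrArg of (tensorClass_one_left X.cls)
    exact DFunLike.congr_fun this a
  mul_one a := by
    have : (comp.flip (mk (Biset.regular G)) : BurnsideGroup G G →+ _) = AddMonoidHom.id _ :=
      hom_ext fun X => by
        change comp (mk X) (mk _) = mk X
        rw [comp_mk]
        exact congrArg of (tensorClass_one_right X.cls)
    exact DFunLike.congr_fun this a
  zsmul := (inferInstance : AddCommGroup (BurnsideGroup G G)).zsmul
  zsmul_zero' := (inferInstance : AddCommGroup (BurnsideGroup G G)).zsmul_zero'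
  zsmul_succ' := (inferInstance : AddCommGroup (BurnsideGroup G G)).zsmul_succ'
  zsmul_neg' := (inferInstance : AddCommGroup (BurnsideGroup G G)).zsmul_neg'
  nsmul := (inferInstance : AddCommGroup (BurnsideGroup G G)).nsmul
  nsmul_zero := (inferInstance : AddCommGroup (BurnsideGroup G G)).nsmul_zero
  nsmul_succ := (inferInstance : AddCommGroup (BurnsideGroup G G)).nsmul_succ
  neg_add_cancel := neg_add_cancel
  sub_eq_add_neg := sub_eq_add_neg

section Ring

variable {G : Type u} [Group G] [Finite G]

theorem mk_mul_mk (X Y : Biset G G) : mk X * mk Y = mk (X.tensor Y) := comp_mk X Y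

theorem one_def : (1 : BurnsideGroup G G) = mk (Biset.regular G) := rfl

theorem dual_mul (a b : BurnsideGroup G G) : dual (a * b) = dual b * dual a := dual_comp a b

theorem dual_one : dual (1 : BurnsideGroup G G) = 1 :=
  (dual_mk _).trans (congrArg of oppositeClass_one)

end Ring

end BurnsideGroup

/-- The group of inner automorphisms. -/
def Inn (G : Type u) [Group G] : Subgroup (MulAut G) :=
  (MulAut.conj : G →* MulAut G).range

instance (G : Type u) [Group G] : (Inn G).Normal := ⟨by
  rintro _ ⟨a, rfl⟩ φ
  refine ⟨φ a, ?_⟩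
  ext x
  simp [MulAut.mul_apply]⟩

/-- The outer automorphism group. -/
abbrev Out (G : Type u) [Group G] : Type u := MulAut G ⧸ Inn G

/-- The class of an automorphism in the outer automorphism group. -/
def outMk {G : Type u} [Group G] : MulAut G →* Out G := QuotientGroup.mk' (Inn G)

theorem outMk_conj {G : Type u} [Group G] (a : G) : outMk (MulAut.conj a) = 1 :=
  (QuotientGroup.eq_one_iff _).2 ⟨a, rfl⟩

/-- The subgroup `{(φ h, h)}` of `G × G`, encoded by the quintuple `(G, 1, φ, G, 1)`. -/
def graph {G : Type u} [Group G] (φ : MulAut G) : Subgroup (G × G) where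
  carrier := {p | φ p.2 = p.1}
  mul_mem' := by
    rintro ⟨a, b⟩ ⟨c, d⟩ (h₁ : φ b = a) (h₂ : φ d = c)
    change φ (b * d) = a * c
    rw [map_mul, h₁, h₂]
  one_mem' := map_one φ
  inv_mem' := by
    rintro ⟨a, b⟩ (h : φ b = a)
    change φ b⁻¹ = a⁻¹
    rw [map_inv, h]

section Eta

variable {G : Type u} [Group G]

theorem mem_graph {φ : MulAut G} {g h : G} : (g, h) ∈ graph φ ↔ φ h = g := Iff.rfl

theorem graph_injective : Function.Injective (graph : MulAut G → Subgroup (G × G)) := by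
  intro φ ψ h
  ext x
  have : (φ x, x) ∈ graph ψ := h ▸ mem_graph.2 rfl
  exact this.symm

variable [Finite G]

/-- The biset `G` with `h • x • g = h x φ(g)`. -/
def twist (φ : MulAut G) : Biset G G :=
  { carrier := G
    right :=
      { smul := fun g x => x * φ (unop g)
        one_smul := fun x => by
          change x * φ 1 = x
          simp
        mul_smul := fun a b x => by
          change x * φ (unop b * unop a) = x * φ (unop b) * φ (unop a)
          simp [mul_assoc] }
    comm := fun g h x => (mul_assoc g x (φ h)).symm }

theorem coset_graph (φ : MulAut G) : (Biset.coset (graph φ)).cls = (twist φ).cls := by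
  let E : (G × G) ⧸ graph φ ≃ G :=
    { toFun := fun q => Quotient.liftOn' q (fun p => p.1 * (φ p.2)⁻¹) (by
        rintro ⟨a, b⟩ ⟨c, d⟩ h
        have h' : φ (b⁻¹ * d) = a⁻¹ * c := QuotientGroup.leftRel_apply.1 h
        change a * (φ b)⁻¹ = c * (φ d)⁻¹
        rw [map_mul, map_inv] at h'
        rw [eq_mul_inv_iff_mul_eq, mul_assoc, h', mul_inv_cancel_left])
      invFun := fun x => QuotientGroup.mk (x, 1)
      left_inv := by
        rintro ⟨a, b⟩
        refine QuotientGroup.eq.2 ?_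
        change φ (1⁻¹ * b) = (a * (φ b)⁻¹)⁻¹ * a
        simp
      right_inv := fun x => by
        change x * (φ 1)⁻¹ = x
        simp }
  refine cls_eq (X := Biset.coset (graph φ)) (Y := twist φ) E ?_ ?_
  · rintro g ⟨a, b⟩
    change g * a * (φ (1 * b))⁻¹ = g * (a * (φ b)⁻¹)
    simp [mul_assoc]
  · rintro h ⟨a, b⟩
    change 1 * a * (φ (h⁻¹ * b))⁻¹ = a * (φ b)⁻¹ * φ h
    simp [mul_assoc]

theorem twist_one : (twist (1 : MulAut G)).cls = (Biset.regular G).cls :=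
  cls_eq (X := twist (1 : MulAut G)) (Y := Biset.regular G) (Equiv.refl G)
    (fun _ _ => rfl) (fun _ _ => rfl)

theorem twist_conj (a : G) : (twist (MulAut.conj a)).cls = (Biset.regular G).cls := by
  let E : G ≃ G := Equiv.mulRight a
  refine cls_eq (X := twist (MulAut.conj a)) (Y := Biset.regular G) E
    (fun g (x : G) => ?_) (fun g (x : G) => ?_)
  · exact mul_assoc g x a
  · change x * (a * g * a⁻¹) * a = x * a * g
    simp [mul_assoc]

theorem twist_mul (φ ψ : MulAut G) :
    ((twist φ).tensor (twist ψ)).cls = (twist (φ * ψ)).cls := by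
  let E : ((twist φ).tensor (twist ψ)).carrier ≃ G :=
    { toFun := Biset.tlift (X := twist φ) (Y := twist ψ) (fun (x y : G) => x * φ y)
        (fun h (x y : G) => by
          change x * φ h * φ y = x * φ (h * y)
          simp [mul_assoc])
      invFun := fun x => Biset.tmk (X := twist φ) (Y := twist ψ) x (1 : G)
      left_inv := fun p => by
        obtain ⟨x, y, rfl⟩ := tmk_surj p
        change G at x y
        have := tmk_smul (X := twist φ) (Y := twist ψ) y x (1 : G)
        exact this.trans (congrArg (Biset.tmk (X := twist φ) (Y := twist ψ) x) (mul_one y))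
      right_inv := fun (x : G) => by
        change x * φ 1 = x
        simp }
  refine cls_eq (X := (twist φ).tensor (twist ψ)) (Y := twist (φ * ψ)) E
    (fun g p => ?_) (fun g p => ?_)
  · obtain ⟨x, y, rfl⟩ := tmk_surj p
    exact mul_assoc (G := G) g x (φ y)
  · obtain ⟨x, y, rfl⟩ := tmk_surj p
    change G at x y
    change x * φ (y * ψ g) = x * φ y * φ (ψ g)
    simp [mul_assoc]

theorem twist_opposite (φ : MulAut G) : (twist φ).opposite.cls = (twist φ⁻¹).cls := by
  refine cls_eq (X := (twist φ).opposite) (Y := twist φ⁻¹)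
    ((Equiv.inv G).trans φ⁻¹.toEquiv) (fun g (x : G) => ?_) (fun g (x : G) => ?_)
  · change φ⁻¹ (x * φ g⁻¹)⁻¹ = g * φ⁻¹ x⁻¹
    simp
  · change φ⁻¹ (g⁻¹ * x)⁻¹ = φ⁻¹ x⁻¹ * φ⁻¹ g
    simp

/-- The homomorphism `φ ↦ [G × G / {(φ h, h)}]` on automorphisms. -/
noncomputable def etaAut (G : Type u) [Group G] [Finite G] : MulAut G →* BurnsideGroup G G where
  toFun φ := BurnsideGroup.mk (Biset.coset (graph φ))
  map_one' := congrArg BurnsideGroup.of ((coset_graph 1).trans twist_one)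
  map_mul' φ ψ := by
    rw [BurnsideGroup.mk_mul_mk]
    refine congrArg BurnsideGroup.of ?_
    rw [tensor_congr (coset_graph φ) (coset_graph ψ), twist_mul, coset_graph]

/-- The homomorphism on outer automorphisms induced by `etaAut`. -/
noncomputable def etaOut (G : Type u) [Group G] [Finite G] : Out G →* BurnsideGroup G G :=
  QuotientGroup.lift (Inn G) (etaAut G) (by
    rintro _ ⟨a, rfl⟩
    exact congrArg BurnsideGroup.of ((coset_graph _).trans (twist_conj a)))

/-- The ring homomorphism `η : ℤ Out(G) → B(G, G)` that sends the class of `φ` to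
`[G × G / {(φ h, h)}]`. -/
noncomputable def eta (G : Type u) [Group G] [Finite G] :
    MonoidAlgebra ℤ (Out G) →+* BurnsideGroup G G :=
  (MonoidAlgebra.lift ℤ (BurnsideGroup G G) (Out G) (etaOut G)).toRingHom

theorem eta_single (φ : MulAut G) (n : ℤ) :
    eta G (MonoidAlgebra.single (outMk φ) n) =
      n • BurnsideGroup.mk (Biset.coset (graph φ)) :=
  MonoidAlgebra.lift_single (etaOut G) (outMk φ) n

theorem dual_mk_coset_graph (φ : MulAut G) :
    BurnsideGroup.dual (BurnsideGroup.mk (Biset.coset (graph φ))) =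
      BurnsideGroup.mk (Biset.coset (graph φ⁻¹)) := by
  have h : BurnsideGroup.mk (Biset.coset (graph φ)) = BurnsideGroup.mk (twist φ) :=
    congrArg BurnsideGroup.of (coset_graph φ)
  rw [h, BurnsideGroup.dual_mk]
  exact congrArg BurnsideGroup.of ((twist_opposite φ).trans (coset_graph φ⁻¹).symm)

end Eta

section Rho

variable {G H K : Type u} [Group G] [Group H] [Group K]

/-- The stabilizer of `x` in `G × H`, for the action `(g, h) x = g x h⁻¹`. -/
def Biset.stab (X : Biset G H) (x : X.carrier) : Subgroup (G × H) where
  carrier := {p | p.1 • op p.2⁻¹ • x = x}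
  mul_mem' := by
    rintro ⟨a, b⟩ ⟨c, d⟩ (h₁ : a • op b⁻¹ • x = x) (h₂ : c • op d⁻¹ • x = x)
    change (a * c) • op (b * d)⁻¹ • x = x
    rw [mul_inv_rev, op_mul, mul_smul, mul_smul, smul_comm c, h₂, h₁]
  one_mem' := by
    change (1 : G) • op (1 : H)⁻¹ • x = x
    simp
  inv_mem' := by
    rintro ⟨a, b⟩ (h : a • op b⁻¹ • x = x)
    change a⁻¹ • op b⁻¹⁻¹ • x = x
    rw [inv_inv]
    calc a⁻¹ • op b • x = a⁻¹ • op b • a • op b⁻¹ • x := by rw [h]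
      _ = x := by rw [← X.comm]; simp

theorem mem_stab {X : Biset G H} {x : X.carrier} {g : G} {h : H} :
    (g, h) ∈ X.stab x ↔ g • x = op h • x := by
  change g • op h⁻¹ • x = x ↔ _
  rw [smul_comm, op_inv, inv_smul_eq_iff]

/-- Two points of a biset lie in the same orbit of `G × H`. -/
def Biset.orbitSetoid (X : Biset G H) : Setoid X.carrier where
  r x y := ∃ (g : G) (h : H), y = g • op h • x
  iseqv :=
    { refl := fun x => ⟨1, 1, by simp⟩
      symm := by
        rintro x y ⟨g, h, rfl⟩
        exact ⟨g⁻¹, h⁻¹, by rw [← X.comm]; simp⟩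
      trans := by
        rintro x y z ⟨g, h, rfl⟩ ⟨a, b, rfl⟩
        exact ⟨a * g, h * b, by rw [← X.comm]; simp [mul_smul]⟩ }

/-- The set of `G × H`-orbits of a `(G, H)`-biset. -/
def Biset.Orbits (X : Biset G H) : Type u := Quotient X.orbitSetoid

instance (X : Biset G H) : Finite X.Orbits := Quotient.finite _

open Classical in
/-- The value of `ρ` on `[G × G / M]`: the class of `φ` if `M` is encoded by `(G, 1, φ, G, 1)`,
and `0` for all other subgroups. -/
noncomputable def rhoSubgroup (M : Subgroup (G × G)) : MonoidAlgebra ℤ (Out G) :=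
  if h : ∃ φ : MulAut G, M = graph φ then MonoidAlgebra.single (outMk h.choose) 1 else 0

theorem rhoSubgroup_graph (φ : MulAut G) :
    rhoSubgroup (graph φ) = MonoidAlgebra.single (outMk φ) 1 := by
  have h : ∃ ψ : MulAut G, graph φ = graph ψ := ⟨φ, rfl⟩
  rw [rhoSubgroup, dif_pos h, ← graph_injective h.choose_spec]

theorem rhoSubgroup_of_not {M : Subgroup (G × G)} (h : ¬ ∃ φ : MulAut G, M = graph φ) :
    rhoSubgroup M = 0 := dif_neg h

theorem rhoSubgroup_ne_zero {M : Subgroup (G × G)} (h : rhoSubgroup M ≠ 0) :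
    ∃ φ : MulAut G, M = graph φ := by
  by_contra h'
  exact h (rhoSubgroup_of_not h')

theorem graph_of_conj {M N : Subgroup (G × G)} (a b : G)
    (hMN : ∀ g h, (g, h) ∈ N ↔ (a⁻¹ * g * a, b * h * b⁻¹) ∈ M) {φ : MulAut G}
    (hφ : M = graph φ) : N = graph (MulAut.conj a * φ * MulAut.conj b) := by
  ext ⟨g, h⟩
  rw [hMN, hφ, mem_graph, mem_graph]
  simp only [MulAut.mul_apply, MulAut.conj_apply]
  rw [eq_comm, mul_assoc, inv_mul_eq_iff_eq_mul, ← eq_mul_inv_iff_mul_eq, eq_comm]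

theorem rhoSubgroup_conj {M N : Subgroup (G × G)} (a b : G)
    (hMN : ∀ g h, (g, h) ∈ N ↔ (a⁻¹ * g * a, b * h * b⁻¹) ∈ M) :
    rhoSubgroup N = rhoSubgroup M := by
  by_cases h : ∃ φ : MulAut G, M = graph φ
  · obtain ⟨φ, hφ⟩ := h
    rw [graph_of_conj a b hMN hφ, hφ, rhoSubgroup_graph, rhoSubgroup_graph, map_mul, map_mul,
      outMk_conj, outMk_conj, one_mul, mul_one]
  · rw [rhoSubgroup_of_not h, rhoSubgroup_of_not]
    rintro ⟨φ, hφ⟩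
    refine h ⟨_, graph_of_conj a⁻¹ b⁻¹ (fun g k => ?_) hφ⟩
    rw [hMN]
    simp [mul_assoc]

theorem mem_stab_smul {X : Biset G H} {x : X.carrier} (a : G) (b : H) (g : G) (h : H) :
    (g, h) ∈ X.stab (a • op b • x) ↔ (a⁻¹ * g * a, b * h * b⁻¹) ∈ X.stab x := by
  have h₁ : g • a • op b • x = a • op b • (a⁻¹ * g * a) • x := by
    rw [← X.comm]; simp [smul_smul, mul_assoc]
  have h₂ : op h • a • op b • x = a • op b • op (b * h * b⁻¹) • x := by
    rw [← X.comm]; simp [smul_smul, ← op_mul, mul_assoc]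
  rw [mem_stab, mem_stab, h₁, h₂, smul_left_cancel_iff, smul_left_cancel_iff]

/-- The value of `ρ` on an orbit of a biset. -/
noncomputable def Biset.rhoOrbit (X : Biset G G) : X.Orbits → MonoidAlgebra ℤ (Out G) :=
  Quotient.lift (fun x => rhoSubgroup (X.stab x)) (by
    rintro x y ⟨a, b, rfl⟩
    exact (rhoSubgroup_conj a b (mem_stab_smul a b)).symm)

/-- The class of a point in the set of orbits. -/
def Biset.orbitMk (X : Biset G H) (x : X.carrier) : X.Orbits := Quotient.mk X.orbitSetoid x

theorem orbitMk_surj {X : Biset G H} (o : X.Orbits) : ∃ x, o = X.orbitMk x := by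
  obtain ⟨x, rfl⟩ := Quotient.exists_rep o
  exact ⟨x, rfl⟩

theorem orbitMk_eq_iff {X : Biset G H} {x y : X.carrier} :
    X.orbitMk x = X.orbitMk y ↔ ∃ (g : G) (h : H), y = g • op h • x :=
  Quotient.eq (r := X.orbitSetoid)

theorem rhoOrbit_mk {X : Biset G G} (x : X.carrier) :
    X.rhoOrbit (X.orbitMk x) = rhoSubgroup (X.stab x) := rfl

/-- The value of `ρ` on `[X]`: the sum over the orbits `G × G / M` of `X` of the values at `M`. -/
noncomputable def Biset.rho (X : Biset G G) : MonoidAlgebra ℤ (Out G) :=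
  ∑ᶠ o : X.Orbits, X.rhoOrbit o

theorem rho_eq_of_equiv {X Y : Biset G G} (e : X.Orbits ≃ Y.Orbits)
    (h : ∀ o, X.rhoOrbit o = Y.rhoOrbit (e o)) : X.rho = Y.rho :=
  finsum_eq_of_bijective e e.bijective h

theorem rho_congr {X Y : Biset G G} (h : X.cls = Y.cls) : X.rho = Y.rho := by
  obtain ⟨e, e₁, e₂⟩ := exists_iso_of_cls_eq h
  refine rho_eq_of_equiv (Quotient.congr e fun x y => ?_) ?_
  · refine exists_congr fun a => exists_congr fun b => ?_
    rw [← e₂, ← e₁, e.injective.eq_iff]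
  · intro o
    obtain ⟨x, rfl⟩ := orbitMk_surj o
    change rhoSubgroup (X.stab x) = rhoSubgroup (Y.stab (e x))
    congr 1
    ext ⟨a, b⟩
    rw [mem_stab, mem_stab, ← e₁, ← e₂, e.injective.eq_iff]

theorem rho_empty : (Biset.empty G G).rho = 0 := by
  have : IsEmpty (Biset.empty G G).Orbits := ⟨fun o => by
    obtain ⟨x, rfl⟩ := orbitMk_surj o
    exact PEmpty.elim x⟩
  exact finsum_of_isEmpty _

theorem rho_sum (X Y : Biset G G) : (X.sum Y).rho = X.rho + Y.rho := by
  classical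
  let e : X.Orbits ⊕ Y.Orbits ≃ (X.sum Y).Orbits :=
    { toFun := Sum.elim
        (Quotient.lift (fun x => (X.sum Y).orbitMk (Sum.inl x)) (by
          rintro x _ ⟨a, b, rfl⟩
          exact orbitMk_eq_iff.2 ⟨a, b, rfl⟩))
        (Quotient.lift (fun y => (X.sum Y).orbitMk (Sum.inr y)) (by
          rintro x _ ⟨a, b, rfl⟩
          exact orbitMk_eq_iff.2 ⟨a, b, rfl⟩))
      invFun := Quotient.lift
        (fun s => Sum.map (fun x => X.orbitMk x) (fun y => Y.orbitMk y) s) (by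
          rintro (x | x) _ ⟨a, b, rfl⟩
          · exact congrArg Sum.inl (orbitMk_eq_iff.2 ⟨a, b, rfl⟩)
          · exact congrArg Sum.inr (orbitMk_eq_iff.2 ⟨a, b, rfl⟩))
      left_inv := by
        rintro (o | o)
        · obtain ⟨x, rfl⟩ := orbitMk_surj o
          rfl
        · obtain ⟨x, rfl⟩ := orbitMk_surj o
          rfl
      right_inv := fun o => by
        obtain ⟨x | x, rfl⟩ := orbitMk_surj o <;> rfl }
  have he : ∀ s, Sum.elim X.rhoOrbit Y.rhoOrbit s = (X.sum Y).rhoOrbit (e s) := by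
    rintro (o | o)
    · obtain ⟨x, rfl⟩ := orbitMk_surj o
      change rhoSubgroup (X.stab x) = rhoSubgroup ((X.sum Y).stab (Sum.inl x))
      congr 1
      ext ⟨a, b⟩
      exact ⟨fun h => (mem_stab (X := X.sum Y)).2 (congrArg Sum.inl (mem_stab.1 h)),
        fun h => mem_stab.2 (Sum.inl_injective ((mem_stab (X := X.sum Y)).1 h))⟩
    · obtain ⟨x, rfl⟩ := orbitMk_surj o
      change rhoSubgroup (Y.stab x) = rhoSubgroup ((X.sum Y).stab (Sum.inr x))
      congr 1
      ext ⟨a, b⟩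
      exact ⟨fun h => (mem_stab (X := X.sum Y)).2 (congrArg Sum.inr (mem_stab.1 h)),
        fun h => mem_stab.2 (Sum.inr_injective ((mem_stab (X := X.sum Y)).1 h))⟩
  have := Fintype.ofFinite X.Orbits
  have := Fintype.ofFinite Y.Orbits
  have h := finsum_eq_of_bijective e e.bijective he
  rw [finsum_eq_sum_of_fintype, Fintype.sum_sum_type] at h
  rw [Biset.rho, Biset.rho, Biset.rho, ← h, finsum_eq_sum_of_fintype, finsum_eq_sum_of_fintype]
  rfl

theorem mem_stab_tmk {X : Biset G H} {Y : Biset H K} {x : X.carrier} {y : Y.carrier}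
    {g : G} {k : K} : (g, k) ∈ (X.tensor Y).stab (Biset.tmk x y) ↔
      ∃ h : H, (g, h) ∈ X.stab x ∧ (h, k) ∈ Y.stab y := by
  rw [mem_stab, smul_tmk, op_smul_tmk, tmk_eq_iff]
  refine exists_congr fun h => ?_
  rw [mem_stab, mem_stab, op_inv, eq_inv_smul_iff, eq_comm, eq_comm (a := op k • y)]

theorem stab_tmk_graph {X Y : Biset G G} {x : X.carrier} {y : Y.carrier} {φ ψ : MulAut G}
    (hx : X.stab x = graph φ) (hy : Y.stab y = graph ψ) :
    (X.tensor Y).stab (Biset.tmk x y) = graph (φ * ψ) := by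
  ext ⟨g, k⟩
  rw [mem_stab_tmk, hx, hy]
  simp only [mem_graph, MulAut.mul_apply]
  constructor
  · rintro ⟨h, h₁, h₂⟩
    rw [h₂, h₁]
  · intro h
    exact ⟨ψ k, h, rfl⟩

theorem exists_graph_of_graph [Finite G] {M : Subgroup (G × G)} (h₁ : ∀ g, ∃ h, (g, h) ∈ M)
    (h₂ : ∀ g, (g, 1) ∈ M → g = 1) : ∃ φ : MulAut G, M = graph φ := by
  choose f hf using h₁
  have key : ∀ {g g' h : G}, (g, h) ∈ M → (g', h) ∈ M → g = g' := fun {g g' h} h₁ h₃ => by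
    have := M.mul_mem h₁ (M.inv_mem h₃)
    simp only [Prod.inv_mk, Prod.mk_mul_mk, mul_inv_cancel] at this
    exact mul_inv_eq_one.1 (h₂ _ this)
  have hinj : Function.Injective f := fun g g' h => key (hf g) (h ▸ hf g')
  have hbij : Function.Bijective f := Finite.injective_iff_bijective.1 hinj
  have hmem : ∀ {g h : G}, (g, h) ∈ M → f g = h := fun {g h} hgh => by
    obtain ⟨g', rfl⟩ := hbij.2 h
    rw [key hgh (hf g')]
  let φ : MulAut G := MulEquiv.symm
    { Equiv.ofBijective f hbij with
      map_mul' := fun a b => hmem (M.mul_mem (hf a) (hf b)) }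
  refine ⟨φ, ?_⟩
  ext ⟨g, h⟩
  rw [mem_graph]
  have hφ : φ h = g ↔ h = f g :=
    (MulEquiv.symm_apply_eq (e := { Equiv.ofBijective f hbij with
      map_mul' := fun a b => hmem (M.mul_mem (hf a) (hf b)) }))
  rw [hφ]
  exact ⟨fun h' => (hmem h').symm, fun h' => h' ▸ hf g⟩

theorem exists_graph_swap {M N : Subgroup (G × G)} (hMN : ∀ g h, (g, h) ∈ N ↔ (h, g) ∈ M)
    {φ : MulAut G} (hφ : M = graph φ) : N = graph φ⁻¹ := by
  ext ⟨g, h⟩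
  rw [hMN, hφ, mem_graph, mem_graph]
  change φ g = h ↔ φ.symm h = g
  rw [MulEquiv.symm_apply_eq, eq_comm]

/-- The subgroup with the two coordinates exchanged. -/
def swapSubgroup (M : Subgroup (G × H)) : Subgroup (H × G) :=
  M.comap (MulEquiv.prodComm (M := H) (N := G)).toMonoidHom

theorem mem_swapSubgroup {M : Subgroup (G × H)} {g : G} {h : H} :
    (h, g) ∈ swapSubgroup M ↔ (g, h) ∈ M := Iff.rfl

theorem stab_graph_of_tmk [Finite G] {X Y : Biset G G} {x : X.carrier} {y : Y.carrier}
    {θ : MulAut G} (h : (X.tensor Y).stab (Biset.tmk x y) = graph θ) :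
    (∃ φ : MulAut G, X.stab x = graph φ) ∧ ∃ ψ : MulAut G, Y.stab y = graph ψ := by
  have hθ : ∀ g k : G, (∃ h : G, (g, h) ∈ X.stab x ∧ (h, k) ∈ Y.stab y) ↔ θ k = g :=
    fun g k => by rw [← mem_stab_tmk, h, mem_graph]
  constructor
  · refine exists_graph_of_graph (fun g => ?_) (fun g hg => ?_)
    · obtain ⟨h, h₁, -⟩ := (hθ g (θ⁻¹ g)).2 (MulAut.apply_inv_self G θ g)
      exact ⟨h, h₁⟩
    · have := (hθ g 1).1 ⟨1, hg, (Y.stab y).one_mem⟩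
      rw [← this, map_one]
  · obtain ⟨ψ, hψ⟩ := exists_graph_of_graph (M := swapSubgroup (Y.stab y))
      (fun k => by
        obtain ⟨h, -, h₁⟩ := (hθ (θ k) k).2 rfl
        exact ⟨h, h₁⟩)
      (fun k hk => by
        have := (hθ 1 k).1 ⟨1, (X.stab x).one_mem, hk⟩
        exact (map_eq_one_iff θ θ.injective).1 this)
    exact ⟨ψ⁻¹, exists_graph_swap (fun _ _ => Iff.rfl) hψ⟩

theorem graph_stab_smul {X : Biset G G} {x : X.carrier} {φ : MulAut G} (h : X.stab x = graph φ)
    (a b : G) : ∃ ψ : MulAut G, X.stab (a • op b • x) = graph ψ :=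
  ⟨_, graph_of_conj a b (mem_stab_smul a b) h⟩

theorem rho_tensor [Finite G] (X Y : Biset G G) : (X.tensor Y).rho = X.rho * Y.rho := by
  classical
  have := Fintype.ofFinite X.Orbits
  have := Fintype.ofFinite Y.Orbits
  have := Fintype.ofFinite (X.tensor Y).Orbits
  rw [Biset.rho, Biset.rho, Biset.rho, finsum_eq_sum_of_fintype, finsum_eq_sum_of_fintype,
    finsum_eq_sum_of_fintype, Finset.sum_mul_sum, ← Finset.sum_product', eq_comm]
  have hrep : ∀ Z : Biset G G, ∃ r : Z.Orbits → Z.carrier, ∀ o, Z.orbitMk (r o) = o := fun Z => by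
    choose r hr using fun o : Z.Orbits => orbitMk_surj o
    exact ⟨r, fun o => (hr o).symm⟩
  obtain ⟨r, hr⟩ := hrep X
  obtain ⟨s, hs⟩ := hrep Y
  have hval : ∀ p : X.Orbits × Y.Orbits, X.rhoOrbit p.1 * Y.rhoOrbit p.2 =
      rhoSubgroup (X.stab (r p.1)) * rhoSubgroup (Y.stab (s p.2)) := fun p => by
    rw [← rhoOrbit_mk, ← rhoOrbit_mk, hr, hs]
  refine Finset.sum_bij_ne_zero
    (fun p _ _ => (X.tensor Y).orbitMk (Biset.tmk (r p.1) (s p.2)))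
    (fun _ _ _ => Finset.mem_univ _) ?_ ?_ ?_
  · intro p _ _ q _ _ h
    obtain ⟨a, b, h⟩ := orbitMk_eq_iff.1 h
    rw [op_smul_tmk, smul_tmk] at h
    obtain ⟨c, h₁, h₂⟩ := tmk_eq_iff.1 h.symm
    refine Prod.ext ?_ ?_
    · rw [← hr p.1, ← hr q.1, orbitMk_eq_iff]
      exact ⟨a, c⁻¹, by rw [h₁, X.comm]⟩
    · rw [← hs p.2, ← hs q.2, orbitMk_eq_iff]
      exact ⟨c, b, h₂⟩
  · intro o _ ho
    obtain ⟨p, rfl⟩ := orbitMk_surj o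
    obtain ⟨x, y, rfl⟩ := tmk_surj p
    obtain ⟨θ, hθ⟩ := rhoSubgroup_ne_zero ho
    obtain ⟨⟨φ, hφ⟩, ψ, hψ⟩ := stab_graph_of_tmk hθ
    obtain ⟨a, b, hx⟩ := orbitMk_eq_iff.1 (hr (X.orbitMk x)).symm
    obtain ⟨c, d, hy⟩ := orbitMk_eq_iff.1 (hs (Y.orbitMk y)).symm
    refine ⟨(X.orbitMk x, Y.orbitMk y), Finset.mem_product.2 ⟨Finset.mem_univ _,
      Finset.mem_univ _⟩, ?_, ?_⟩
    · rw [rhoOrbit_mk, rhoOrbit_mk, hφ, hψ, rhoSubgroup_graph, rhoSubgroup_graph,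
        MonoidAlgebra.single_mul_single, one_mul]
      exact (MonoidAlgebra.single_eq_zero).not.2 one_ne_zero
    · dsimp only
      rw [hx, hy, eq_comm, orbitMk_eq_iff]
      have hm : (b * c, ψ⁻¹ (b * c)) ∈ Y.stab y := by
        rw [hψ, mem_graph]
        exact MulAut.apply_inv_self G ψ _
      rw [mem_stab] at hm
      refine ⟨a, ψ⁻¹ (b * c) * d, ?_⟩
      rw [← smul_tmk, tmk_smul, smul_smul b c, Y.comm, hm, op_smul_tmk, op_mul, mul_smul]
  · intro p _ h
    rw [hval] at h
    obtain ⟨φ, hφ⟩ := rhoSubgroup_ne_zero (left_ne_zero_of_mul h)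
    obtain ⟨ψ, hψ⟩ := rhoSubgroup_ne_zero (right_ne_zero_of_mul h)
    rw [hval, rhoOrbit_mk, stab_tmk_graph hφ hψ, hφ, hψ, rhoSubgroup_graph, rhoSubgroup_graph,
      rhoSubgroup_graph, MonoidAlgebra.single_mul_single, map_mul, one_mul]

/-- The coset of `p` as a point of `G × H / M`. -/
def Biset.cosetMk [Finite G] [Finite H] (M : Subgroup (G × H)) (p : G × H) :
    (Biset.coset M).carrier :=
  (QuotientGroup.mk p : (G × H) ⧸ M)

theorem smul_cosetMk [Finite G] [Finite H] (M : Subgroup (G × H)) (g : G) (p : G × H) :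
    g • Biset.cosetMk M p = Biset.cosetMk M (g * p.1, p.2) :=
  congrArg (Biset.cosetMk M) (Prod.ext rfl (one_mul p.2))

theorem op_smul_cosetMk [Finite G] [Finite H] (M : Subgroup (G × H)) (h : H) (p : G × H) :
    op h • Biset.cosetMk M p = Biset.cosetMk M (p.1, h⁻¹ * p.2) :=
  congrArg (Biset.cosetMk M) (Prod.ext (one_mul p.1) rfl)

theorem cosetMk_eq_iff [Finite G] [Finite H] {M : Subgroup (G × H)} {p q : G × H} :
    Biset.cosetMk M p = Biset.cosetMk M q ↔ p⁻¹ * q ∈ M := QuotientGroup.eq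

theorem rho_coset [Finite G] (M : Subgroup (G × G)) : (Biset.coset M).rho = rhoSubgroup M := by
  have hs : ∀ p : G × G, (Biset.coset M).orbitMk (Biset.cosetMk M p) =
      (Biset.coset M).orbitMk (Biset.cosetMk M 1) := fun p => by
    rw [eq_comm, orbitMk_eq_iff]
    refine ⟨p.1, p.2⁻¹, ?_⟩
    rw [op_smul_cosetMk, smul_cosetMk]
    simp
  let U : Unique (Biset.coset M).Orbits :=
    { default := (Biset.coset M).orbitMk (Biset.cosetMk M 1)
      uniq := fun o => by
        obtain ⟨x, rfl⟩ := orbitMk_surj o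
        obtain ⟨p, rfl⟩ := QuotientGroup.mk_surjective x
        exact hs p }
  rw [Biset.rho, finsum_unique]
  change rhoSubgroup ((Biset.coset M).stab (Biset.cosetMk M 1)) = _
  congr 1
  ext ⟨a, b⟩
  rw [mem_stab, op_smul_cosetMk, smul_cosetMk, eq_comm, cosetMk_eq_iff]
  simp

/-- The involution of `ℤ Out(G)` that inverts the elements of `Out(G)`. -/
noncomputable def invOut (G : Type u) [Group G] :
    MonoidAlgebra ℤ (Out G) →+ MonoidAlgebra ℤ (Out G) where
  toFun := MonoidAlgebra.mapDomain (fun m => m⁻¹)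
  map_zero' := MonoidAlgebra.mapDomain_zero _
  map_add' := MonoidAlgebra.mapDomain_add _

theorem rhoSubgroup_swap {M N : Subgroup (G × G)} (hMN : ∀ g h, (g, h) ∈ N ↔ (h, g) ∈ M) :
    rhoSubgroup N = invOut G (rhoSubgroup M) := by
  by_cases h : ∃ φ : MulAut G, M = graph φ
  · obtain ⟨φ, hφ⟩ := h
    rw [exists_graph_swap hMN hφ, hφ, rhoSubgroup_graph, rhoSubgroup_graph]
    exact ((MonoidAlgebra.mapDomain_single).trans (by rw [map_inv])).symm
  · rw [rhoSubgroup_of_not h, rhoSubgroup_of_not, map_zero]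
    rintro ⟨φ, hφ⟩
    exact h ⟨_, exists_graph_swap (fun g k => (hMN k g).symm) hφ⟩

theorem rho_opposite (X : Biset G G) : X.opposite.rho = invOut G X.rho := by
  have h : invOut G X.rho = ∑ᶠ o : X.Orbits, invOut G (X.rhoOrbit o) :=
    AddMonoidHom.map_finsum _ (Set.toFinite _)
  rw [h, Biset.rho, eq_comm]
  let e : X.Orbits ≃ X.opposite.Orbits := Quotient.congr (Equiv.refl _) (fun x y => by
    constructor
    · rintro ⟨a, b, rfl⟩
      refine ⟨b⁻¹, a⁻¹, ?_⟩
      change a • op b • x = op b⁻¹⁻¹ • a⁻¹⁻¹ • x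
      rw [inv_inv, inv_inv, X.comm]
    · rintro ⟨a, b, h⟩
      refine ⟨b⁻¹, a⁻¹, h.trans ?_⟩
      exact (X.comm b⁻¹ a⁻¹ x).symm)
  refine finsum_eq_of_bijective e e.bijective (fun o => ?_)
  obtain ⟨x, rfl⟩ := orbitMk_surj o
  refine (rhoSubgroup_swap fun g h => ?_).symm
  rw [← inv_mem_iff, mem_stab]
  change op (g⁻¹)⁻¹ • x = (h⁻¹)⁻¹ • x ↔ _
  rw [mem_stab, inv_inv, inv_inv, eq_comm]

end Rho

section Units

variable (G : Type u) [Group G] [Finite G]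

/-- The ring homomorphism `ρ : B(G, G) → ℤ Out(G)` that sends `[G × G / M]` to the class of `φ` if
`M` is encoded by `(G, 1, φ, G, 1)`, and to `0` for all other subgroups `M` of `G × G`. -/
noncomputable def rho : BurnsideGroup G G →+* MonoidAlgebra ℤ (Out G) :=
  let f : BurnsideGroup G G →+ MonoidAlgebra ℤ (Out G) := BurnsideGroup.lift
    { toFun := Quotient.lift Biset.rho (fun _ _ h => rho_congr (Quotient.sound h))
      map_zero' := rho_empty
      map_add' := by
        rintro ⟨X⟩ ⟨Y⟩
        exact rho_sum X Y }
  have hf : ∀ X : Biset G G, f (BurnsideGroup.mk X) = X.rho := fun _ => BurnsideGroup.lift_of _ _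
  { f with
    map_one' := by
      change f (BurnsideGroup.mk (Biset.regular G)) = 1
      rw [hf, ← rho_congr ((coset_graph (1 : MulAut G)).trans twist_one), rho_coset,
        rhoSubgroup_graph, map_one, MonoidAlgebra.one_def]
    map_mul' := fun a b => by
      have h₂ : ∀ X : Biset G G, f.comp (AddMonoidHom.mulLeft (BurnsideGroup.mk X)) =
          (AddMonoidHom.mulLeft (f (BurnsideGroup.mk X))).comp f := fun X =>
        BurnsideGroup.hom_ext fun Y => by
          change f (BurnsideGroup.mk X * BurnsideGroup.mk Y) =
            f (BurnsideGroup.mk X) * f (BurnsideGroup.mk Y)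
          rw [BurnsideGroup.mk_mul_mk, hf, hf, hf, rho_tensor]
      have h₁ : f.comp (AddMonoidHom.mulRight b) = (AddMonoidHom.mulRight (f b)).comp f :=
        BurnsideGroup.hom_ext fun X => DFunLike.congr_fun (h₂ X) b
      exact DFunLike.congr_fun h₁ a }

variable {G}

theorem rho_mk (X : Biset G G) : rho G (BurnsideGroup.mk X) = X.rho := BurnsideGroup.lift_of _ _

theorem rho_mk_coset (M : Subgroup (G × G)) :
    rho G (BurnsideGroup.mk (Biset.coset M)) = rhoSubgroup M := by
  rw [rho_mk, rho_coset]

theorem rho_dual (a : BurnsideGroup G G) : rho G (BurnsideGroup.dual a) = invOut G (rho G a) := by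
  have : ((rho G).toAddMonoidHom).comp BurnsideGroup.dual =
      (invOut G).comp (rho G).toAddMonoidHom := BurnsideGroup.hom_ext fun X => by
    change rho G (BurnsideGroup.dual (BurnsideGroup.mk X)) = invOut G (rho G (BurnsideGroup.mk X))
    rw [BurnsideGroup.dual_mk, rho_mk, rho_mk, rho_opposite]
  exact DFunLike.congr_fun this a

variable (G)

/-- The group `B_∘(G, G)` of orthogonal units: units `u` of `B(G, G)` with `u u° = u° u = 1`. -/
def orthogonalUnits : Subgroup (BurnsideGroup G G)ˣ where
  carrier := {u | (u : BurnsideGroup G G) * BurnsideGroup.dual (u : BurnsideGroup G G) = 1 ∧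
    BurnsideGroup.dual (u : BurnsideGroup G G) * (u : BurnsideGroup G G) = 1}
  mul_mem' := by
    rintro u v ⟨h₁, h₂⟩ ⟨h₃, h₄⟩
    simp only [Set.mem_ofPred_eq, Units.val_mul, BurnsideGroup.dual_mul]
    constructor
    · rw [mul_assoc, ← mul_assoc (v : BurnsideGroup G G), h₃, one_mul, h₁]
    · rw [mul_assoc, ← mul_assoc (BurnsideGroup.dual (u : BurnsideGroup G G)), h₂, one_mul, h₄]
  one_mem' := by simp [BurnsideGroup.dual_one]
  inv_mem' := by
    rintro u ⟨h₁, h₂⟩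
    have h : BurnsideGroup.dual (u : BurnsideGroup G G) = ((u⁻¹ : (BurnsideGroup G G)ˣ) : _) :=
      (Units.inv_eq_of_mul_eq_one_right h₁).symm
    simp only [Set.mem_ofPred_eq, ← h, BurnsideGroup.dual_dual]
    exact ⟨h₂, h₁⟩

/-- The embedding of `Out(G)` in the unit group of `ℤ Out(G)`. -/
noncomputable def outUnit : Out G →* (MonoidAlgebra ℤ (Out G))ˣ :=
  (Units.map (MonoidAlgebra.of ℤ (Out G))).comp (toUnits (G := Out G)).toMonoidHom

/-- The subgroup `⟨-1, Out(G)⟩` of the unit group of `ℤ Out(G)`. -/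
noncomputable def signedOut : Subgroup (MonoidAlgebra ℤ (Out G))ˣ :=
  Subgroup.closure ({-1} ∪ Set.range (outUnit G))

variable {G}

theorem eta_mem_orthogonalUnits {v : (MonoidAlgebra ℤ (Out G))ˣ} (hv : v ∈ signedOut G) :
    Units.map (eta G).toMonoidHom v ∈ orthogonalUnits G := by
  have : signedOut G ≤ (orthogonalUnits G).comap (Units.map (eta G).toMonoidHom) := by
    refine (Subgroup.closure_le _).2 ?_
    rintro v (hv | ⟨o, rfl⟩)
    · rw [Set.mem_singleton_iff.1 hv]
      change eta G ((-1 : (MonoidAlgebra ℤ (Out G))ˣ) : _) *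
          BurnsideGroup.dual (eta G ((-1 : (MonoidAlgebra ℤ (Out G))ˣ) : _)) = 1 ∧
        BurnsideGroup.dual (eta G ((-1 : (MonoidAlgebra ℤ (Out G))ˣ) : _)) *
          eta G ((-1 : (MonoidAlgebra ℤ (Out G))ˣ) : _) = 1
      simp [BurnsideGroup.dual_one]
    · obtain ⟨φ, rfl⟩ := QuotientGroup.mk'_surjective (Inn G) o
      have h : eta G (MonoidAlgebra.single (outMk φ) 1) = etaAut G φ := by
        rw [eta_single, one_smul]
        rfl
      change eta G (MonoidAlgebra.single (outMk φ) 1) *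
          BurnsideGroup.dual (eta G (MonoidAlgebra.single (outMk φ) 1)) = 1 ∧
        BurnsideGroup.dual (eta G (MonoidAlgebra.single (outMk φ) 1)) *
          eta G (MonoidAlgebra.single (outMk φ) 1) = 1
      have hd : BurnsideGroup.dual (etaAut G φ) = etaAut G φ⁻¹ := dual_mk_coset_graph φ
      rw [h, hd, ← map_mul, ← map_mul, mul_inv_cancel, inv_mul_cancel, map_one]
      exact ⟨rfl, rfl⟩
  exact this hv

theorem coeff_mul_invOut {G : Type u} [Group G] [Fintype (Out G)]
    (a : MonoidAlgebra ℤ (Out G)) :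
    (a * invOut G a).coeff 1 = ∑ m, a.coeff m * a.coeff m := by
  classical
  have hs : ∀ {p : Out G × Out G},
      p ∈ Finset.univ.map ⟨fun m : Out G => (m, m⁻¹), fun x y h => (Prod.ext_iff.1 h).1⟩ ↔
        p.1 * p.2 = 1 := by
    rintro ⟨x, y⟩
    simp only [Finset.mem_map, Finset.mem_univ, true_and]
    constructor
    · rintro ⟨m, hm⟩
      obtain ⟨rfl, rfl⟩ := Prod.ext_iff.1 hm
      exact mul_inv_cancel _
    · intro h
      exact ⟨x, Prod.ext rfl (eq_inv_of_mul_eq_one_right h).symm⟩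
  rw [MonoidAlgebra.coeff_mul_antidiag _ _ _ _ hs, Finset.sum_map]
  refine Finset.sum_congr rfl fun m _ => ?_
  congr 1
  exact Finsupp.mapDomain_apply inv_injective _ _

theorem rho_mem_signedOut {u : (BurnsideGroup G G)ˣ} (hu : u ∈ orthogonalUnits G) :
    Units.map (rho G).toMonoidHom u ∈ signedOut G := by
  classical
  have : Finite (MulAut G) := Finite.of_injective (fun φ : MulAut G => (φ : G → G))
    DFunLike.coe_injective
  have := Fintype.ofFinite (Out G)
  set a : MonoidAlgebra ℤ (Out G) := rho G u with ha
  have h₁ : a * invOut G a = 1 := by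
    rw [ha, ← rho_dual, ← map_mul, hu.1, map_one]
  have h₂ : ∑ m, a.coeff m * a.coeff m = 1 := by
    rw [← coeff_mul_invOut, h₁, MonoidAlgebra.coeff_one_one]
  obtain ⟨m, hm⟩ : ∃ m, a.coeff m ≠ 0 := by
    by_contra! h
    simp [h] at h₂
  have h₃ : ∀ n, n ≠ m → a.coeff n = 0 := by
    intro n hn
    by_contra h
    have h₃ := Finset.sum_le_sum_of_subset_of_nonneg (Finset.subset_univ {m, n})
      (fun i _ _ => mul_self_nonneg (a.coeff i))
    rw [h₂, Finset.sum_pair (Ne.symm hn)] at h₃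
    have h₄ := mul_self_pos.2 hm
    have h₅ := mul_self_pos.2 h
    omega
  have h₄ : a.coeff m = 1 ∨ a.coeff m = -1 := by
    rw [Finset.sum_eq_single m (fun n _ hn => by rw [h₃ n hn, mul_zero]) (by simp)] at h₂
    exact mul_self_eq_one_iff.1 h₂
  have h₅ : a = MonoidAlgebra.single m (a.coeff m) := by
    ext n
    by_cases hn : n = m
    · rw [hn, MonoidAlgebra.coeff_single, Finsupp.single_eq_same]
    · rw [h₃ n hn, MonoidAlgebra.coeff_single, Finsupp.single_eq_of_ne hn]
  have hmem : outUnit G m ∈ signedOut G := Subgroup.subset_closure (Or.inr ⟨m, rfl⟩)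
  have hneg : (-1 : (MonoidAlgebra ℤ (Out G))ˣ) ∈ signedOut G :=
    Subgroup.subset_closure (Or.inl rfl)
  rcases h₄ with h | h
  · convert hmem using 1
    refine Units.ext ?_
    change a = MonoidAlgebra.single m 1
    rw [h₅, h]
  · convert mul_mem hneg hmem using 1
    refine Units.ext ?_
    change a = -1 * MonoidAlgebra.single m 1
    rw [h₅, h, neg_one_mul]
    exact MonoidAlgebra.single_neg _ _

variable (G)

/-- The restriction of `η` to a homomorphism `⟨-1, Out(G)⟩ → B_∘(G, G)`. -/
noncomputable def etaUnits : signedOut G →* orthogonalUnits G :=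
  ((Units.map (eta G).toMonoidHom).comp (signedOut G).subtype).codRestrict (orthogonalUnits G)
    (fun v => eta_mem_orthogonalUnits v.2)

/-- The restriction `ρ^×` of `ρ` to a homomorphism `B_∘(G, G) → ⟨-1, Out(G)⟩`. -/
noncomputable def rhoUnits : orthogonalUnits G →* signedOut G :=
  ((Units.map (rho G).toMonoidHom).comp (orthogonalUnits G).subtype).codRestrict (signedOut G)
    (fun u => rho_mem_signedOut u.2)

end Units

end DoubleBurnside

/-! Two facts carry the proof: `ρ ∘ η` is the identity, and `η` takes central values when `G` is
cyclic. A group with a retraction onto a subgroup is the semidirect product of that subgroup and the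
kernel of the retraction; if the subgroup is central, the product is direct. Applied to the
restrictions of `η` and `ρ` to `⟨-1, Out(G)⟩` and `B_∘(G, G)`, this is the asserted decomposition
(`rhoUnits_etaUnits`, `exists_mulEquiv_range_prod_ker`).

That `ρ ∘ η = id` (`rho_eta`) holds for every finite group and can be read off on the basis
`Out(G)`. Centrality (`eta_range_le_center`) is where cyclicity enters. An automorphism `φ` of a
cyclic group is a power map `g ↦ g ^ m`, so `φ × φ` is the `m`-th power map of the abelian group `G
× G` and maps each subgroup `M` into itself. Conjugating `[G × G / M]` by `[G × G / Δ_φ(G)]`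
replaces `M` by its image under `φ × φ`, hence changes nothing.

The argument is carried out on bisets rather than on subgroups. Stability of stabilizers under `φ ×
φ` makes `a r b ↦ φ(a) r φ(b)` well defined on the orbit of a point `r`. Glued over orbit
representatives, these maps give a `φ`-semilinear bijection of any finite biset `X`
(`exists_semilinear_bijective`), and such a bijection is the same thing as an isomorphism between
the two products of `X` with the biset `G` twisted by `φ` (`twist_tensor_comm`). -/

namespace DoubleBurnside

open MulOpposite

/-! ### Semilinear bijections of bisets over a cyclic group -/

section Cyclic

variable {G : Type u} [Group G] [IsCyclic G]

/-- Since `φ` is a power map, `φ × φ` preserves the stabilizer of `x`, and a coincidence between two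
points of the orbit of `x` is exactly a membership in that stabilizer. This is the well-definedness
needed to transport `φ` to an orbit. -/
theorem smul_map_eq_of_smul_eq {X : Biset G G} (φ : MulAut G) {x : X.carrier} {a b a' b' : G}
    (h : a • op b • x = a' • op b' • x) : φ a • op (φ b) • x = φ a' • op (φ b') • x := by
  let : CommGroup G := IsCyclic.commGroup
  -- The only use of cyclicity beyond commutativity: an endomorphism of a cyclic group is `g ↦ g ^
  -- m` for one integer `m`.
  obtain ⟨m, hm⟩ := MonoidHom.map_cyclic φ.toMonoidHom
  have hm' : ∀ g, φ g = g ^ m := hm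
  -- In the stabilizer convention `(g, h)` acts by `g x h⁻¹`, which accounts for the inverse falling
  -- on `d` and not on `d'`. Commutativity allows the right-hand factors to be taken in either
  -- order.
  have key : ∀ c d c' d' : G, c • op d • x = c' • op d' • x ↔
      (c'⁻¹ * c, d⁻¹ * d') ∈ X.stab x := fun c d c' d' => by
    rw [mem_stab, mul_smul, inv_smul_eq_iff, mul_comm d⁻¹, op_mul, mul_smul, op_inv, ← op_inv,
      X.comm c' d⁻¹, op_inv, eq_inv_smul_iff, X.comm c d]
  rw [key] at h ⊢
  have := (X.stab x).zpow_mem h m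
  -- The `m`-th power of the stabilizer element, expanded with `mul_zpow` (hence commutativity), is
  -- the element that `key` attaches to the images under `φ`.
  rwa [Prod.pow_mk, mul_zpow, mul_zpow, inv_zpow, inv_zpow, ← hm', ← hm', ← hm', ← hm'] at this

/-- For cyclic `G`, each `φ ∈ Aut(G)` acts on every biset by a `φ`-semilinear bijection. -/
theorem exists_semilinear_bijective (X : Biset G G) (φ : MulAut G) :
    ∃ e : X.carrier → X.carrier, e.Bijective ∧
      ∀ (a b : G) (x : X.carrier), e (a • op b • x) = φ a • op (φ b) • e x := by
  let : CommGroup G := IsCyclic.commGroup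
  have hrep : ∀ o : X.Orbits, ∃ r : X.carrier, X.orbitMk r = o := fun o =>
    (orbitMk_surj o).imp fun _ h => h.symm
  choose r hr using hrep
  have hdec : ∀ x : X.carrier, ∃ p : G × G, x = p.1 • op p.2 • r (X.orbitMk x) := fun x => by
    obtain ⟨a, b, h⟩ := orbitMk_eq_iff.1 (hr (X.orbitMk x))
    exact ⟨(a, b), h⟩
  -- The coordinates `p x` of `x` relative to its orbit representative are not unique; `he` below
  -- shows that `e` does not depend on this choice.
  choose p hp using hdec
  let e : X.carrier → X.carrier := fun x =>
    φ (p x).1 • op (φ (p x).2) • r (X.orbitMk x)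
  have he : ∀ (o : X.Orbits) (a b : G), e (a • op b • r o) = φ a • op (φ b) • r o := by
    intro o a b
    have ho : X.orbitMk (a • op b • r o) = o :=
      (orbitMk_eq_iff.2 ⟨a, b, rfl⟩).symm.trans (hr o)
    have h := hp (a • op b • r o)
    change φ _ • op (φ _) • r (X.orbitMk (a • op b • r o)) = _
    rw [ho] at h ⊢
    exact (smul_map_eq_of_smul_eq φ h).symm
  -- A preimage of `a r b` is `φ⁻¹(a) r φ⁻¹(b)`. Injectivity then comes for free, because the
  -- carrier is finite.
  have hsurj : e.Surjective := fun y => by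
    refine ⟨φ⁻¹ (p y).1 • op (φ⁻¹ (p y).2) • r (X.orbitMk y), ?_⟩
    rw [he, MulAut.apply_inv_self, MulAut.apply_inv_self]
    exact (hp y).symm
  refine ⟨e, ⟨Finite.injective_iff_surjective.2 hsurj, hsurj⟩, fun a b x => ?_⟩
  have hmerge : ∀ (a b c d : G) (y : X.carrier),
      a • op b • c • op d • y = (a * c) • op (d * b) • y := fun a b c d y => by
    rw [← X.comm, op_mul, mul_smul, mul_smul]
  -- Both sides are brought to the form `c r d`, with `r` the representative of the orbit of `x`,
  -- where `he` computes `e`.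
  rw [hp x, hmerge, he, he, hmerge, map_mul, map_mul]

/-! ### Centrality of the image of `η` -/

variable [Finite G]

/-- Normalizing the `G`-coordinate to `1` identifies both products with the set `X`: on the
left-hand product the left action becomes `a • x = φ⁻¹(a) x`, on the right-hand one the right action
becomes `x • b = x φ(b)`. A `φ`-semilinear bijection of `X` intertwines these two structures. -/
theorem twist_tensor_comm (φ : MulAut G) (X : Biset G G) :
    ((twist φ).tensor X).cls = (X.tensor (twist φ)).cls := by
  obtain ⟨e, hbij, he⟩ := exists_semilinear_bijective X φ
  have hl : ∀ (a : G) (x : X.carrier), e (a • x) = φ a • e x := fun a x => by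
    simpa using he a 1 x
  have hright : ∀ (b : G) (x : X.carrier), e (op b • x) = op (φ b) • e x := fun b x => by
    simpa using he 1 b x
  -- Under the normalizations this is `e` itself. It is balanced because `g φ(h) e(x) = g e(h x)`.
  let f : ((twist φ).tensor X).carrier → (X.tensor (twist φ)).carrier :=
    Biset.tlift (X := twist φ)
      (fun (g : G) x => Biset.tmk (Y := twist φ) (g • e x) (1 : G))
      (fun h (g : G) x => by
        change Biset.tmk (Y := twist φ) ((g * φ h) • e x) (1 : G) = _
        rw [hl, mul_smul])
  -- The twisted right action on `twist φ` is transitive, so `g = 1 · φ(φ⁻¹ g)` can be moved across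
  -- the tensor sign.
  have hnorm : ∀ q : ((twist φ).tensor X).carrier, ∃ x,
      q = Biset.tmk (X := twist φ) (1 : G) x := fun q => by
    obtain ⟨g, x, rfl⟩ := tmk_surj q
    change G at g
    refine ⟨φ⁻¹ g • x, ?_⟩
    refine Eq.trans ?_ (tmk_smul (X := twist φ) (φ⁻¹ g) (1 : G) x)
    refine congrArg (fun w => Biset.tmk (X := twist φ) w x) ?_
    change g = 1 * φ (φ⁻¹ g)
    rw [MulAut.apply_inv_self, one_mul]
  have hf : ∀ x, f (Biset.tmk (X := twist φ) (1 : G) x) =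
      Biset.tmk (Y := twist φ) (e x) (1 : G) := fun x =>
    congrArg (fun w => Biset.tmk (Y := twist φ) w (1 : G)) (one_smul G (e x))
  have hfbij : f.Bijective := by
    constructor
    · intro q q' h
      obtain ⟨x, rfl⟩ := hnorm q
      obtain ⟨x', rfl⟩ := hnorm q'
      rw [hf, hf] at h
      obtain ⟨k, h₁, h₂⟩ := tmk_eq_iff.1 h
      -- The left action on `twist φ` is free, so the element of `G` relating two pairs with second
      -- coordinate `1` is trivial, and the first coordinates agree.
      have hk : k = 1 := ((mul_one k).symm.trans h₂.symm)
      rw [hk, inv_one, op_one, one_smul] at h₁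
      rw [hbij.1 h₁]
    · intro q
      obtain ⟨x, g, rfl⟩ := tmk_surj q
      change G at g
      -- A point `(x, g)` of the target equals `(x g, 1)`, so a preimage is found by solving `e y =
      -- x g`.
      obtain ⟨y, hy⟩ := hbij.2 (op g • x)
      refine ⟨Biset.tmk (X := twist φ) (1 : G) y, ?_⟩
      rw [hf, hy]
      refine (tmk_smul (Y := twist φ) g x (1 : G)).trans ?_
      exact congrArg (Biset.tmk (Y := twist φ) x) (mul_one g)
  refine cls_eq (Equiv.ofBijective f hfbij) (fun a q => ?_) (fun b q => ?_)
  · obtain ⟨g, x, rfl⟩ := tmk_surj q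
    exact congrArg (fun w => Biset.tmk (Y := twist φ) w (1 : G)) (mul_smul (α := G) a g (e x))
  -- On normalized points, `e(x b) = e(x) φ(b)`; moving `φ(b)` across the tensor sign gives the
  -- second coordinate `φ(b)`, which is `1 · φ(b)`, the twisted right action of `b` on `1`.
  · obtain ⟨x, rfl⟩ := hnorm q
    refine (hf (op b • x)).trans (Eq.trans ?_ (congrArg (fun w => op b • w) (hf x).symm))
    rw [hright]
    refine (tmk_smul (Y := twist φ) (φ b) (e x) (1 : G)).trans ?_
    refine congrArg (Biset.tmk (Y := twist φ) (e x)) ?_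
    change φ b * 1 = 1 * φ b
    rw [mul_one, one_mul]

/-- Both sides are additive in `b`, so it suffices to let `b` be the class of a biset; there the
transitive biset of `Δ_φ(G)` may be replaced by the isomorphic `twist φ`. -/
theorem etaAut_commute (φ : MulAut G) (b : BurnsideGroup G G) :
    b * etaAut G φ = etaAut G φ * b := by
  have h : etaAut G φ = BurnsideGroup.mk (twist φ) :=
    congrArg BurnsideGroup.of (coset_graph φ)
  have : AddMonoidHom.mulRight (etaAut G φ) = AddMonoidHom.mulLeft (etaAut G φ) :=
    BurnsideGroup.hom_ext fun X => by
      change BurnsideGroup.mk X * etaAut G φ = etaAut G φ * BurnsideGroup.mk X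
      rw [h, BurnsideGroup.mk_mul_mk, BurnsideGroup.mk_mul_mk]
      exact congrArg BurnsideGroup.of (twist_tensor_comm φ X).symm
  exact DFunLike.congr_fun this b

/-- The image is additively generated by the classes `etaAut G φ`, and the center is an additive
subgroup. -/
theorem eta_range_le_center : (eta G).range ≤ Subring.center (BurnsideGroup G G) := by
  rintro _ ⟨x, rfl⟩
  induction x using MonoidAlgebra.induction_linear with
  | zero => rw [map_zero]; exact zero_mem _
  | add x y hx hy => rw [map_add]; exact add_mem hx hy
  | single o n =>
    obtain ⟨φ, rfl⟩ := QuotientGroup.mk'_surjective (Inn G) o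
    have h : eta G (MonoidAlgebra.single (QuotientGroup.mk' (Inn G) φ) n) = n • etaAut G φ :=
      eta_single φ n
    rw [h]
    exact zsmul_mem (Subring.mem_center_iff.2 (etaAut_commute φ)) n

end Cyclic

/-! ### The section `η` of `ρ` -/

section Split

variable {G : Type u} [Group G] [Finite G]

/-- By additivity it is enough to check multiples of the class of `φ`: `η` sends this class to the
transitive biset of the graph of `φ`, from which `ρ` recovers it. No cyclicity is involved. -/
theorem rho_eta (x : MonoidAlgebra ℤ (Out G)) : rho G (eta G x) = x := by
  induction x using MonoidAlgebra.induction_linear with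
  | zero => rw [map_zero, map_zero]
  | add x y hx hy => rw [map_add, map_add, hx, hy]
  | single o n =>
    obtain ⟨φ, rfl⟩ := QuotientGroup.mk'_surjective (Inn G) o
    change rho G (eta G (MonoidAlgebra.single (outMk φ) n)) = MonoidAlgebra.single (outMk φ) n
    rw [eta_single, map_zsmul, rho_mk_coset, rhoSubgroup_graph, MonoidAlgebra.smul_single,
      zsmul_one, Int.cast_id]

theorem rhoUnits_etaUnits (v : signedOut G) : rhoUnits G (etaUnits G v) = v :=
  Subtype.ext (Units.ext (rho_eta _))

end Split

/-! ### Direct product decompositions from central retractions -/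

/-- A group that retracts onto a central subgroup is the direct product of that subgroup and the
kernel of the retraction. -/
theorem exists_mulEquiv_range_prod_ker {A B : Type*} [Group A] [Group B] (s : A →* B) (r : B →* A)
    (hrs : ∀ a, r (s a) = a) (hs : ∀ a b, Commute (s a) b) :
    ∃ e : s.range × r.ker ≃* B, ∀ (a : s.range) (b : r.ker), e (a, b) = (a : B) * (b : B) := by
  let f : s.range × r.ker →* B := MonoidHom.noncommCoprod s.range.subtype r.ker.subtype (by
    rintro ⟨_, a, rfl⟩ b
    exact hs a b)
  refine ⟨MulEquiv.ofBijective f ⟨(injective_iff_map_eq_one f).2 ?_, fun u => ?_⟩, fun _ _ => rfl⟩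
  · rintro ⟨⟨_, a, rfl⟩, ⟨b, hb⟩⟩ (h : s a * b = 1)
    -- Applying `r` to `s a * b = 1` removes `b`, which lies in the kernel, and leaves `a`.
    have ha : a = 1 := by
      have := congrArg r h
      rwa [map_mul, hrs, MonoidHom.mem_ker.1 hb, mul_one, map_one] at this
    subst ha
    rw [map_one, one_mul] at h
    subst h
    exact Prod.ext (Subtype.ext (map_one s)) rfl
  -- The component of `u` in the image of `s` is forced to be `s (r u)`, since `r` must agree on
  -- both; the kernel component is the quotient.
  · refine ⟨(⟨s (r u), r u, rfl⟩, ⟨(s (r u))⁻¹ * u, ?_⟩), mul_inv_cancel_left (s (r u)) u⟩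
    rw [MonoidHom.mem_ker, map_mul, map_inv, hrs, inv_mul_cancel]

end DoubleBurnside

theorem lemma5 {G : Type u} [Group G] [Finite G] [IsCyclic G] :
    (DoubleBurnside.eta G).range ≤ Subring.center (DoubleBurnside.BurnsideGroup G G) ∧
    ∃ e : (DoubleBurnside.etaUnits G).range × (DoubleBurnside.rhoUnits G).ker ≃*
        DoubleBurnside.orthogonalUnits G,
      ∀ (a : (DoubleBurnside.etaUnits G).range) (b : (DoubleBurnside.rhoUnits G).ker),
        e (a, b) = (a : DoubleBurnside.orthogonalUnits G) * (b : DoubleBurnside.orthogonalUnits G) := by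
  refine ⟨DoubleBurnside.eta_range_le_center,
    DoubleBurnside.exists_mulEquiv_range_prod_ker _ _ DoubleBurnside.rhoUnits_etaUnits
      fun v u => Subtype.ext (Units.ext ?_)⟩
  -- Commutation of orthogonal units is tested on the underlying ring elements, and the one coming
  -- from `etaUnits` is by definition a value of `eta`, hence central.
  exact (Subring.mem_center_iff.1 (DoubleBurnside.eta_range_le_center ⟨_, rfl⟩) _).symm
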